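/- Fix $a>0$ and $T>0$. Let $\mathcal P=\{\rho=(\rho_1,\rho_2)\in\mathbb R^2:\rho_1<\rho_2\}$, let $\mathcal T=\{\rho\in\mathcal P:\ -a\le\rho_1,\ \rho_2\le a\}$, and put $\mathcal L_\rho=\{(u,1):u>\rho_1\}\cup\{(u,-1):u<\rho_2\}$. For a continuous input $u:[0,t]\to\mathbb R$ and $(u(0),z_0)\in\mathcal L_\rho$, let $[h^\rho(u,z_0)](t)\in\{-1,1\}$ be the output of the delayed relay: it starts from $z_0$, switches to $+1$ when $u$ reaches $\rho_2$, switches to $-1$ when $u$ reaches $\rho_1$, and is otherwise unchanged. The virgin state is $z_v=-1$ where $\rho_2>-\rho_1$ and $z_v=+1$ where $\rho_2<-\rho_1$. Let $\tilde{\mathcal S}$ (resp. $\tilde{\mathcal S}_L$) be the set of Borel functions $z:\mathcal P\to\{-1,1\}$ of the form $z(\rho)=[h^\rho(u,z_v(\rho))](T)$ with $u\in C^0([0,T])$ (resp. $u$ $L$-Lipschitz) compatible with $z_v$. The graph of $z$ is $\xi_z=\partial\{z=-1\}\cap\partial\{z=+1\}$. Consider Riemann data $(u_0,z_0)=(u_l,z_l)$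 for $x<0$ and $(u_r,z_r)$ for $x>0$, with $u_l,u_r\in[-a,a]$, with $z_l,z_r\in\tilde{\mathcal S}_L$ for some $L>0$, with $(u_l,z_l(\rho)),(u_r,z_r(\rho))\in\mathcal L_\rho$ for a.e. $\rho\in\mathcal T$, and such that inside $\mathcal T$ the graphs $\xi_{z_l}$, $\xi_{z_r}$ consist of finitely many horizontal and vertical segments, apart from a part of the antidiagonal $\rho_2=-\rho_1$. For $v$ between $u_r$ and $u_l$ put $g(v)=1+2\,|\{r:(r,v)\in\mathcal T,\ z_r(r,v)=-1\}|$ if $u_r\le u_l$, and $g(v)=1+2\,|\{r:(v,r)\in\mathcal T,\ z_r(v,r)=+1\}|$ if $u_l<u_r$. Define, for $t\ge0$, $u(x,t)$ as the supremum of $u_r$ and all $v\in[u_r,u_l]$ with $x\,g(v)\le t$ if $u_r\le u_l$ (as the infimum of $u_r$ and all $v\in[u_l,u_r]$ with $x\,g(v)\le t$ if $u_l<u_r$), that is, $u(x,t)=f^{-1}(x/t)$ with $f=1/g$ in the generalized sense. Put $z(x,t;\rho)=[h^\rho(u(x,\cdot),z_0(x;\rho))](t)$ and $w(x,t)=\int_{\mathcal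 T}z(x,t;\rho)\,d\rho$. Then $(u,w)$ is the solution of the Riemann problem for $u_t+w_t+u_x=0$, in the following sense. For every $x\ne0$, $u(x,\cdot)$ is continuous on $[0,\infty)$ with $u(x,0)=u_0(x)$. For every $C^1$ function $\phi$ with compact support in $\mathbb R\times[0,\infty)$, $$\int_0^\infty\!\!\int_{\mathbb R}\big[(u+w)\phi_t+u\phi_x\big]\,dx\,dt+\int_{\mathbb R}\Big(u_0(x)+\int_{\mathcal T}z_0(x;\rho)\,d\rho\Big)\phi(x,0)\,dx=0 .$$ If $u_l=u_r$, then $u$ is constant. If $u_r<u_l$, there are finitely many values $u_r=v_0<v_1<\dots<v_{n+1}=u_l$ and affine functions $g_i(y)=1+2c_i(y-m_i)$, $0\le i\le n$, with $c_i=1$, or $c_i=2$ and $m_i=0$, and with $m_i\le v_i$, such that $g=g_i$ on $(v_i,v_{i+1})$, $g_i(v_{i+1})\le g_{i+1}(v_{i+1})$, and for $t>0$ $$u(x,t)=\begin{cases}u_l,& \frac xt\le \frac1{g_n(u_l)},\\ m_i+\frac1{2c_i}\big(\frac tx-1\big),&\frac1{g_i(v_{i+1})}\le\frac xt\le\frac1{g_i(v_i)},\quad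 0\le i\le n,\\ v_{i+1},&\frac1{g_{i+1}(v_{i+1})}\le\frac xt\le\frac1{g_i(v_{i+1})},\quad 0\le i<n,\\ u_r,&\frac1{g_0(u_r)}\le\frac xt.\end{cases}$$ If $u_l<u_r$, the same holds with $v_0>v_1>\dots>v_{n+1}$, $g_i(y)=1+2c_i(m_i-y)$, $m_i\ge v_i$, and rarefactions $m_i-\frac1{2c_i}(\frac tx-1)$. For every $t\ge 0$ and a.e. $\rho\in\mathcal T$: $z=z_l$ for $x<0$; for $x>0$, $z(x,t;\rho)=+1$ if $\rho_2\le u(x,t)$ and $z=z_r(\rho)$ otherwise when $u_r\le u_l$, while $z(x,t;\rho)=-1$ if $u(x,t)\le\rho_1$ and $z=z_r(\rho)$ otherwise when $u_l\le u_r$. Thus the solution is built from finitely many rarefaction waves and constant pieces, with a possible stationary jump of $z$ at $x=0$. Moreover $(u,w)$ is an entropy solution: for every $k\in\mathbb R$, every $\hat z\in\tilde{\mathcal S}$ with $(k,\hat z(\rho))\in\mathcal L_\rho$ for a.e. $\rho\in\mathcal T$, and every nonnegative $\phi\in C^\infty$ with compact support in $\mathbb R\times(0,\infty)$, $$\int_{\mathbb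 R}\int_0^T\Big[|u-k|+\int_{\mathcal T}|z-\hat z|\,d\rho\Big]\phi_t+|u-k|\,\phi_x\;dt\,dx\ \ge\ 0 .$$ -/

import Mathlib

open Set MeasureTheory
open scoped NNReal ContDiff

namespace PreisachRiemann

noncomputable section

/-! ### Relays and the Preisach plane -/

/-- The half plane of thresholds `ρ = (ρ₁, ρ₂)` with `ρ₁ < ρ₂`. -/
def plane : Set (ℝ × ℝ) := {ρ | ρ.1 < ρ.2}

/-- The triangle with vertices `(-a, -a)`, `(a, a)`, `(-a, a)` in the half plane of thresholds. -/
def triangle (a : ℝ) : Set (ℝ × ℝ) := {ρ | -a ≤ ρ.1 ∧ ρ.1 < ρ.2 ∧ ρ.2 ≤ a}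

/-- The hysteresis region of the relay with thresholds `ρ`. -/
def region (ρ : ℝ × ℝ) : Set (ℝ × ℝ) :=
  {p | ρ.1 < p.1 ∧ p.2 = 1} ∪ {p | p.1 < ρ.2 ∧ p.2 = -1}

open Classical in
/-- The delayed relay with thresholds `ρ`, for a continuous input `u` on `[0, t]` and an initial
state `z₀` compatible with `u 0`: the output at time `t` is `+1` if the input has reached the upper
threshold `ρ₂` and has not been down to `ρ₁` since, it is `-1` if the input has reached the lower
threshold `ρ₁` and has not been up to `ρ₂` since, and it is `z₀` if no threshold was ever reached.
(The first two conditions exclude each other.) -/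
def relay (ρ : ℝ × ℝ) (u : ℝ → ℝ) (z₀ t : ℝ) : ℝ :=
  if ∃ s ∈ Icc 0 t, ρ.2 ≤ u s ∧ ∀ r ∈ Icc s t, ρ.1 < u r then 1
  else if ∃ s ∈ Icc 0 t, u s ≤ ρ.1 ∧ ∀ r ∈ Icc s t, u r < ρ.2 then -1
  else z₀

/-- The virgin state; its values on the null set `ρ₂ = -ρ₁` are left free. -/
def IsVirginState (z : ℝ × ℝ → ℝ) : Prop :=
  ∀ ρ ∈ plane, (z ρ = 1 ∨ z ρ = -1) ∧ (-ρ.1 < ρ.2 → z ρ = -1) ∧ (ρ.2 < -ρ.1 → z ρ = 1)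

/-- The configuration `z` is generated from the virgin state by the input `u` on `[0, T]`. -/
def IsGeneratedBy (T : ℝ) (u : ℝ → ℝ) (z : ℝ × ℝ → ℝ) : Prop :=
  ∃ zv : ℝ × ℝ → ℝ, IsVirginState zv ∧ (∀ ρ ∈ plane, (u 0, zv ρ) ∈ region ρ) ∧
    ∀ ρ ∈ plane, z ρ = relay ρ u (zv ρ) T

/-- Borel configurations of the Preisach plane that are generated from the virgin state by a
continuous input. -/
def states (T : ℝ) : Set (ℝ × ℝ → ℝ) :=
  {z | Measurable (fun ρ : plane => z ρ) ∧
    ∃ u : ℝ → ℝ, ContinuousOn u (Icc 0 T) ∧ IsGeneratedBy T u z}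

/-- Borel configurations of the Preisach plane that are generated from the virgin state by an
`L`-Lipschitz input. -/
def statesLip (T : ℝ) (L : ℝ≥0) : Set (ℝ × ℝ → ℝ) :=
  {z | Measurable (fun ρ : plane => z ρ) ∧
    ∃ u : ℝ → ℝ, LipschitzOnWith L u (Icc 0 T) ∧ IsGeneratedBy T u z}

/-- The input value `k` and the configuration `z` are compatible on the triangle. -/
def Compatible (a k : ℝ) (z : ℝ × ℝ → ℝ) : Prop :=
  ∀ᵐ ρ ∂(volume.restrict (triangle a)), (k, z ρ) ∈ region ρ

/-- The graph separating the relays in state `-1` from those in state `+1`. -/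
def graph (z : ℝ × ℝ → ℝ) : Set (ℝ × ℝ) :=
  frontier {ρ | ρ ∈ plane ∧ z ρ = -1} ∩ frontier {ρ | ρ ∈ plane ∧ z ρ = 1}

/-- Within the triangle, and apart from the part of the antidiagonal `ρ₂ = -ρ₁` inherited from the
virgin state, the graph of `z` lies on finitely many horizontal and vertical lines. As the graph is
antimonotone, it then meets each of these lines in one segment at most. -/
def HasFiniteGraph (a : ℝ) (z : ℝ × ℝ → ℝ) : Prop :=
  ∃ H V : Finset ℝ, ∀ ρ ∈ graph z ∩ triangle a, ρ.2 = -ρ.1 ∨ ρ.2 ∈ H ∨ ρ.1 ∈ V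

/-! ### The solution of the Riemann problem -/

/-- Length of the horizontal segment at height `v` of the relays in the triangle that switch from
`-1` to `+1` when an increasing input passes through `v`. -/
def horizLength (a : ℝ) (z : ℝ × ℝ → ℝ) (v : ℝ) : ℝ :=
  (volume {r : ℝ | (r, v) ∈ triangle a ∧ z (r, v) = -1}).toReal

/-- Length of the vertical segment at abscissa `v` of the relays in the triangle that switch from
`+1` to `-1` when a decreasing input passes through `v`. -/
def vertLength (a : ℝ) (z : ℝ × ℝ → ℝ) (v : ℝ) : ℝ :=
  (volume {r : ℝ | (v, r) ∈ triangle a ∧ z (v, r) = 1}).toReal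

/-- The coefficient `g` in the reduced equation `g(u) u_t + u_x = 0` for an input that increases
from a value with configuration `z`. -/
def gUp (a : ℝ) (z : ℝ × ℝ → ℝ) (v : ℝ) : ℝ := 1 + 2 * horizLength a z v

/-- The coefficient `g` in the reduced equation `g(u) u_t + u_x = 0` for an input that decreases
from a value with configuration `z`. -/
def gDown (a : ℝ) (z : ℝ × ℝ → ℝ) (v : ℝ) : ℝ := 1 + 2 * vertLength a z v

open Classical in
/-- The `u`-component of the solution of the Riemann problem: with `f = 1 / g`, the value
`u (x, t)` between `u_r` and `u_l` is `f⁻¹ (x / t)`, in the sense of the generalized inverse of a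
monotone function (farthest value `v` from `u_r`, on the way to `u_l`, with `x / t ≤ f v`). -/
def riemannU (a ul ur : ℝ) (zr : ℝ × ℝ → ℝ) (x t : ℝ) : ℝ :=
  if ur ≤ ul then sSup (insert ur {v | v ∈ Icc ur ul ∧ x * gUp a zr v ≤ t})
  else sInf (insert ur {v | v ∈ Icc ul ur ∧ x * gDown a zr v ≤ t})

open Classical in
/-- Riemann initial datum: `l` for `x < 0`, `r` otherwise. -/
def riemannDatum {α : Type*} (l r : α) (x : ℝ) : α := if x < 0 then l else r

/-- The relay states of the solution of the Riemann problem: at each point `x` the relays are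
driven by the input `u (x, ·)` from the initial configuration at `x`. -/
def riemannZ (a ul ur : ℝ) (zl zr : ℝ × ℝ → ℝ) (x t : ℝ) (ρ : ℝ × ℝ) : ℝ :=
  relay ρ (fun s => riemannU a ul ur zr x s) (riemannDatum zl zr x ρ) t

/-- The Preisach output `w = ∫_𝒯 z dρ` of the solution of the Riemann problem. -/
def riemannW (a ul ur : ℝ) (zl zr : ℝ × ℝ → ℝ) (x t : ℝ) : ℝ :=
  ∫ ρ in triangle a, riemannZ a ul ur zl zr x t ρ

/-! ### The notions of solution -/

/-- Partial derivative in `t` of a function of `(x, t)`. -/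
def dt (φ : ℝ × ℝ → ℝ) (x t : ℝ) : ℝ := deriv (fun s => φ (x, s)) t

/-- Partial derivative in `x` of a function of `(x, t)`. -/
def dx (φ : ℝ × ℝ → ℝ) (x t : ℝ) : ℝ := deriv (fun y => φ (y, t)) x

/-- Weak formulation of `u_t + w_t + u_x = 0` with initial values `u₀`, `w₀`. -/
def IsWeakSolution (u w : ℝ → ℝ → ℝ) (u₀ w₀ : ℝ → ℝ) : Prop :=
  ∀ φ : ℝ × ℝ → ℝ, ContDiff ℝ 1 φ → HasCompactSupport φ →
    IntegrableOn (fun p : ℝ × ℝ =>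
      (u p.1 p.2 + w p.1 p.2) * dt φ p.1 p.2 + u p.1 p.2 * dx φ p.1 p.2) (univ ×ˢ Ioi 0) ∧
    Integrable (fun x => (u₀ x + w₀ x) * φ (x, 0)) ∧
    (∫ t in Ioi (0 : ℝ), ∫ x : ℝ, ((u x t + w x t) * dt φ x t + u x t * dx φ x t)) +
      ∫ x : ℝ, (u₀ x + w₀ x) * φ (x, 0) = 0

/-- `(u, w)`, with `w = ∫_𝒯 z dρ`, is an entropy solution on `ℝ × [0, T]`. -/
def IsEntropySolution (a T : ℝ) (u w : ℝ → ℝ → ℝ) (z : ℝ → ℝ → ℝ × ℝ → ℝ) : Prop :=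
  (∀ x t, 0 ≤ t → IntegrableOn (z x t) (triangle a) ∧ w x t = ∫ ρ in triangle a, z x t ρ) ∧
  ∀ (k : ℝ) (zhat : ℝ × ℝ → ℝ), zhat ∈ states T → Compatible a k zhat →
    ∀ φ : ℝ × ℝ → ℝ, ContDiff ℝ ∞ φ → HasCompactSupport φ → (∀ p ∈ tsupport φ, 0 < p.2) →
      (∀ p, 0 ≤ φ p) →
      IntegrableOn (fun p : ℝ × ℝ =>
        (|u p.1 p.2 - k| + ∫ ρ in triangle a, |z p.1 p.2 ρ - zhat ρ|) * dt φ p.1 p.2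
          + |u p.1 p.2 - k| * dx φ p.1 p.2) (univ ×ˢ Ioc 0 T) ∧
      0 ≤ ∫ x : ℝ, ∫ t in (0 : ℝ)..T,
        ((|u x t - k| + ∫ ρ in triangle a, |z x t ρ - zhat ρ|) * dt φ x t
          + |u x t - k| * dx φ x t)

/-! ### The wave structure -/

/-- The affine function `1 + 2c(y - m)` for `σ = 1`, `1 + 2c(m - y)` for `σ = -1`. -/
def affineG (σ c m y : ℝ) : ℝ := 1 + 2 * c * (σ * (y - m))

/-- `u` consists of finitely many centred rarefaction waves separated by constant states. The
values `v 0 = u_r, v 1, …, v (n + 1) = u_l` are ordered upwards (`σ = 1`) or downwards (`σ = -1`),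
and between `v i` and `v (i + 1)` the coefficient `g` is `1 ± 2(y - m i)`, or `1 ± 4y` where the
graph follows the antidiagonal. -/
def IsRarefactionFan (σ ul ur : ℝ) (g : ℝ → ℝ) (u : ℝ → ℝ → ℝ) : Prop :=
  ∃ (n : ℕ) (v m c : ℕ → ℝ),
    v 0 = ur ∧ v (n + 1) = ul ∧
    (∀ i ≤ n, σ * v i < σ * v (i + 1)) ∧
    (∀ i ≤ n, (c i = 1 ∨ (c i = 2 ∧ m i = 0)) ∧ σ * m i ≤ σ * v i) ∧
    (∀ i ≤ n, ∀ y, σ * v i < σ * y → σ * y < σ * v (i + 1) → g y = affineG σ (c i) (m i) y) ∧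
    (∀ i < n, affineG σ (c i) (m i) (v (i + 1)) ≤
      affineG σ (c (i + 1)) (m (i + 1)) (v (i + 1))) ∧
    ∀ x t, 0 < t →
      (x / t ≤ 1 / affineG σ (c n) (m n) (v (n + 1)) → u x t = ul) ∧
      (∀ i ≤ n, 1 / affineG σ (c i) (m i) (v (i + 1)) ≤ x / t →
        x / t ≤ 1 / affineG σ (c i) (m i) (v i) →
          u x t = m i + σ / (2 * c i) * (t / x - 1)) ∧
      (∀ i < n, 1 / affineG σ (c (i + 1)) (m (i + 1)) (v (i + 1)) ≤ x / t →
        x / t ≤ 1 / affineG σ (c i) (m i) (v (i + 1)) → u x t = v (i + 1)) ∧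
      (1 / affineG σ (c 0) (m 0) (v 0) ≤ x / t → u x t = ur)

open Classical in
/-- The relay states are constant for `x < 0`; for `x > 0` they arise from `z_r` by a monotone
input from `u_r` to `u (x, t)`. So `z` is constant where `u` is, changes along the rarefaction
waves only, and may jump at `x = 0`. -/
def HasWaveStates (a ul ur : ℝ) (zl zr : ℝ × ℝ → ℝ) (u : ℝ → ℝ → ℝ)
    (z : ℝ → ℝ → ℝ × ℝ → ℝ) : Prop :=
  ∀ x t, 0 ≤ t →
    (x < 0 → ∀ᵐ ρ ∂(volume.restrict (triangle a)), z x t ρ = zl ρ) ∧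
    (0 < x → ur ≤ ul → ∀ᵐ ρ ∂(volume.restrict (triangle a)),
      z x t ρ = if ρ.2 ≤ u x t then 1 else zr ρ) ∧
    (0 < x → ul ≤ ur → ∀ᵐ ρ ∂(volume.restrict (triangle a)),
      z x t ρ = if u x t ≤ ρ.1 then -1 else zr ρ)

/-- What it means that `(u, w)`, `w = ∫_𝒯 z dρ`, is the solution of the Riemann problem: for each
`x ≠ 0` the input `u (x, ·)` is continuous and has the prescribed initial value, `z` is the output
of the relays driven by it, the conservation law holds weakly, and `u` and `z` are made of finitely
many rarefaction waves, constant states, and possibly a jump of `z` at `x = 0`. -/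
def IsRiemannSolution (a ul ur : ℝ) (zl zr : ℝ × ℝ → ℝ) (u w : ℝ → ℝ → ℝ)
    (z : ℝ → ℝ → ℝ × ℝ → ℝ) : Prop :=
  (∀ x, x ≠ 0 → ContinuousOn (u x) (Ici 0) ∧ u x 0 = riemannDatum ul ur x) ∧
  (∀ x, x ≠ 0 → ∀ t, 0 ≤ t → ∀ ρ ∈ triangle a,
    z x t ρ = relay ρ (u x) (riemannDatum zl zr x ρ) t) ∧
  (∀ x t, 0 ≤ t → w x t = ∫ ρ in triangle a, z x t ρ) ∧
  IsWeakSolution u w (riemannDatum ul ur)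
    (fun x => ∫ ρ in triangle a, riemannDatum zl zr x ρ) ∧
  (ur < ul → IsRarefactionFan 1 ul ur (gUp a zr) u) ∧
  (ul < ur → IsRarefactionFan (-1) ul ur (gDown a zr) u) ∧
  (ul = ur → ∀ x t, 0 ≤ t → u x t = ul) ∧
  HasWaveStates a ul ur zl zr u z

end

end PreisachRiemann

/-!
The proof superposes the fronts of the reduced equation. Let `u_r ≤ u_l` first. A configuration
generated from the virgin state is antitone in the thresholds and takes the values `±1`
(`IsConfig`). Hence the relays in state `-1` at height `v` form, up to an end point, the interval
from `lowerEdge v` to `v`, and above the input value `u_r` the lower edge is an antitone function of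
`v` (`IsConfig.lowerEdge_antitone`). The coefficient `g v = 1 + 2 (v - lowerEdge v)` therefore grows
at least with slope `2`, and `u (x, t)`, the generalized inverse of `g` at `t / x`, is the
superposition `u_r + ∫ H_v dv` over `v ∈ [u_r, u_l]` of the indicator functions `H_v` of
`x g(v) ≤ t` (`front`, `riemannU_eq_integral`).

When the front with value `v` passes a point `x > 0`, exactly the relays with upper threshold `v`
in state `-1` switch. So each quantity in the conservation law and in the entropy inequality has the
form `e(x) + ∫ A(v) H_v dv` (`integral_riemannZ_of_le`), and `integral_superposed_fronts` evaluates
its weak balance: apart from boundary terms only the production `B(v) g(v) - A(v)` along each front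
is left, where `A` and `B` are the jumps of the density and of the flux.
* In the conservation law, `A = g` and `B = 1`, and the production vanishes
  (`isWeakSolution_of_le`).
* In the entropy inequality, `B(v)` is the sign of `v - k` and `A = B + q`, where `|q| ≤ g - 1` and,
  by the compatibility of `k` with the comparison state, `q = -(g - 1)` for `v < k`. So the
  production vanishes for `v < k` and is nonnegative for `v > k` (`entropyInequalities_of_le`).

The wave structure comes from the shape of the lower edge: off the boundary of the triangle its
points lie on the graph of the configuration (`IsConfig.lowerEdge_mem_graph`), so that it consists
of finitely many constant and antidiagonal pieces (`exists_subdivision_of_antitone`), on which `g`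
is affine with slope `2` and `4`. Its generalized inverse is then a rarefaction fan
(`isRarefactionFan_of_inverse`).

The case `u_l < u_r` is the image of the first case under the reflection `reflect` of the
thresholds, which changes the signs of the input and of the relay states.
-/

namespace PreisachRiemann

/-! ### Superposition of fronts -/

/-- Indicator function of the region `x γ ≤ t` behind the front that leaves the origin at time `0`
with speed `1 / γ`. At times `t ≥ 0` this region contains the half line `x ≤ 0`. -/
noncomputable def front (γ x t : ℝ) : ℝ := if x * γ ≤ t then 1 else 0

lemma measurable_front {α : Type*} [MeasurableSpace α] {γ x t : α → ℝ} (hγ : Measurable γ)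
    (hx : Measurable x) (ht : Measurable t) : Measurable fun p => front (γ p) (x p) (t p) :=
  Measurable.ite (measurableSet_le (hx.mul hγ) ht) measurable_const measurable_const

lemma abs_front_le (γ x t : ℝ) : |front γ x t| ≤ 1 := by unfold front; split_ifs <;> norm_num

section TestFunctions

variable {φ : ℝ × ℝ → ℝ}

lemma hasDerivAt_dt (hφ : ContDiff ℝ 1 φ) (x t : ℝ) :
    HasDerivAt (fun s => φ (x, s)) (fderiv ℝ φ (x, t) (0, 1)) t := by
  have h1 : HasFDerivAt φ (fderiv ℝ φ (x, t)) (x, t) :=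
    (hφ.differentiable one_ne_zero (x, t)).hasFDerivAt
  exact h1.comp_hasDerivAt t ((hasDerivAt_const t x).prodMk (hasDerivAt_id t))

lemma hasDerivAt_dx (hφ : ContDiff ℝ 1 φ) (x t : ℝ) :
    HasDerivAt (fun y => φ (y, t)) (fderiv ℝ φ (x, t) (1, 0)) x := by
  have h1 : HasFDerivAt φ (fderiv ℝ φ (x, t)) (x, t) :=
    (hφ.differentiable one_ne_zero (x, t)).hasFDerivAt
  exact h1.comp_hasDerivAt x ((hasDerivAt_id x).prodMk (hasDerivAt_const x t))

lemma dt_eq (hφ : ContDiff ℝ 1 φ) : (fun p : ℝ × ℝ => dt φ p.1 p.2) =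
    fun p => fderiv ℝ φ p (0, 1) := funext fun p => (hasDerivAt_dt hφ p.1 p.2).deriv

lemma dx_eq (hφ : ContDiff ℝ 1 φ) : (fun p : ℝ × ℝ => dx φ p.1 p.2) =
    fun p => fderiv ℝ φ p (1, 0) := funext fun p => (hasDerivAt_dx hφ p.1 p.2).deriv

lemma continuous_dt (hφ : ContDiff ℝ 1 φ) : Continuous fun p : ℝ × ℝ => dt φ p.1 p.2 := by
  rw [dt_eq hφ]; exact (hφ.continuous_fderiv one_ne_zero).clm_apply continuous_const

lemma continuous_dx (hφ : ContDiff ℝ 1 φ) : Continuous fun p : ℝ × ℝ => dx φ p.1 p.2 := by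
  rw [dx_eq hφ]; exact (hφ.continuous_fderiv one_ne_zero).clm_apply continuous_const

lemma integrable_dt (hφ : ContDiff ℝ 1 φ) (hc : HasCompactSupport φ) :
    Integrable fun p : ℝ × ℝ => dt φ p.1 p.2 := by
  refine (continuous_dt hφ).integrable_of_hasCompactSupport ?_
  rw [dt_eq hφ]; exact hc.fderiv_apply (𝕜 := ℝ) _

lemma integrable_dx (hφ : ContDiff ℝ 1 φ) (hc : HasCompactSupport φ) :
    Integrable fun p : ℝ × ℝ => dx φ p.1 p.2 := by
  refine (continuous_dx hφ).integrable_of_hasCompactSupport ?_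
  rw [dx_eq hφ]; exact hc.fderiv_apply (𝕜 := ℝ) _

lemma hasCompactSupport_slice (hc : HasCompactSupport φ) (t : ℝ) :
    HasCompactSupport fun x => φ (x, t) := by
  refine HasCompactSupport.intro (hc.image continuous_fst) (K := Prod.fst '' tsupport φ) ?_
  intro x hx
  by_contra h
  exact hx ⟨(x, t), subset_tsupport _ h, rfl⟩

lemma integrable_slice (hφ : ContDiff ℝ 1 φ) (hc : HasCompactSupport φ) (t : ℝ) :
    Integrable fun x => φ (x, t) :=
  (hφ.continuous.comp (by fun_prop)).integrable_of_hasCompactSupport (hasCompactSupport_slice hc t)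

lemma setIntegral_Ioc_dt (hφ : ContDiff ℝ 1 φ) (x : ℝ) {r s : ℝ} (hrs : r ≤ s) :
    ∫ t in Ioc r s, dt φ x t = φ (x, s) - φ (x, r) := by
  rw [← intervalIntegral.integral_of_le hrs]
  refine intervalIntegral.integral_eq_sub_of_hasDerivAt (f := fun t => φ (x, t))
    (fun t _ => ?_) ?_
  · have h := hasDerivAt_dt hφ x t
    rwa [← h.deriv] at h
  · have hx : Continuous fun t : ℝ => (x, t) := by fun_prop
    exact ((continuous_dt hφ).comp hx).intervalIntegrable _ _

lemma contDiff_slice (hφ : ContDiff ℝ 1 φ) (t : ℝ) : ContDiff ℝ 1 fun x => φ (x, t) :=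
  hφ.comp (by fun_prop)

/-- Integration in time across one front. -/
lemma integral_front_mul_dt (hφ : ContDiff ℝ 1 φ) {γ T : ℝ} (hγ : 0 < γ) (hT : 0 < T) (x : ℝ) :
    ∫ t in Ioc 0 T, front γ x t * dt φ x t =
      front γ x T * φ (x, T) - front γ x 0 * φ (x, 0) -
        (Ioc 0 (T / γ)).indicator (fun x => φ (x, x * γ)) x := by
  rcases le_or_gt x 0 with hx | hx
  · have hxg : x * γ ≤ 0 := mul_nonpos_of_nonpos_of_nonneg hx hγ.le
    have h1 : ∀ t, 0 ≤ t → front γ x t = 1 := fun t ht => if_pos (hxg.trans ht)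
    rw [setIntegral_congr_fun (g := fun t => dt φ x t) measurableSet_Ioc
      (fun t ht => by simp only [h1 t ht.1.le, one_mul]), setIntegral_Ioc_dt hφ x hT.le,
      h1 T hT.le, h1 0 le_rfl, indicator_of_notMem (fun h => absurd h.1 hx.not_gt)]
    ring
  · have hxg : 0 < x * γ := mul_pos hx hγ
    have h0 : front γ x 0 = 0 := if_neg hxg.not_ge
    rw [h0]
    have h2 : (fun t => front γ x t * dt φ x t) = (Ici (x * γ)).indicator (fun t => dt φ x t) := by
      ext t
      by_cases h : x * γ ≤ t
      · rw [indicator_of_mem (mem_Ici.2 h), front, if_pos h, one_mul]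
      · rw [indicator_of_notMem (by simpa using h), front, if_neg h, zero_mul]
    rw [h2, setIntegral_indicator measurableSet_Ici]
    by_cases hxT : x * γ ≤ T
    · rw [indicator_of_mem (show x ∈ Ioc 0 (T / γ) from ⟨hx, (le_div_iff₀ hγ).2 hxT⟩), front,
        if_pos hxT]
      have h3 : Ioc 0 T ∩ Ici (x * γ) = Icc (x * γ) T := by
        ext t; simp only [mem_inter_iff, mem_Ioc, mem_Ici, mem_Icc]
        constructor
        · rintro ⟨⟨_, h⟩, h'⟩; exact ⟨h', h⟩
        · rintro ⟨h', h⟩; exact ⟨⟨hxg.trans_le h', h⟩, h'⟩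
      rw [h3, integral_Icc_eq_integral_Ioc, setIntegral_Ioc_dt hφ x hxT]
      ring
    · rw [indicator_of_notMem (fun h => hxT ((le_div_iff₀ hγ).1 h.2)), front, if_neg hxT]
      have h3 : Ioc 0 T ∩ Ici (x * γ) = ∅ := by
        ext t; simp only [mem_inter_iff, mem_Ioc, mem_Ici, mem_empty_iff_false, iff_false]
        rintro ⟨⟨_, h⟩, h'⟩; exact hxT (h'.trans h)
      rw [h3]; simp

/-- Integration in space behind one front. -/
lemma integral_front_mul_dx (hφ : ContDiff ℝ 1 φ) (hc : HasCompactSupport φ) {γ : ℝ} (hγ : 0 < γ)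
    (t : ℝ) : ∫ x, front γ x t * dx φ x t = φ (t / γ, t) := by
  have h2 : (fun x => front γ x t * dx φ x t) =
      (Iic (t / γ)).indicator (deriv fun x => φ (x, t)) := by
    ext x
    by_cases h : x * γ ≤ t
    · rw [indicator_of_mem (mem_Iic.2 ((le_div_iff₀ hγ).2 h)), front, if_pos h, one_mul]; rfl
    · rw [indicator_of_notMem (by simpa [le_div_iff₀ hγ] using h), front, if_neg h, zero_mul]
  rw [h2, integral_indicator measurableSet_Iic,
    HasCompactSupport.integral_Iic_deriv_eq (contDiff_slice hφ t) (hasCompactSupport_slice hc t)]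

lemma integral_dx (hφ : ContDiff ℝ 1 φ) (hc : HasCompactSupport φ) (t : ℝ) :
    ∫ x, dx φ x t = 0 := by
  have hs := hasCompactSupport_slice hc t
  have hd := contDiff_slice hφ t
  refine integral_eq_zero_of_hasDerivAt_of_integrable (f := fun x => φ (x, t)) (fun x => ?_)
    ?_ (integrable_slice hφ hc t)
  · have h := hasDerivAt_dx hφ x t
    rwa [← h.deriv] at h
  · exact (hd.continuous_deriv le_rfl).integrable_of_hasCompactSupport hs.deriv

lemma integral_along_front {γ T : ℝ} (hγ : 0 < γ) (hT : 0 < T) :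
    ∫ t in Ioc 0 T, φ (t / γ, t) = γ * ∫ x in Ioc 0 (T / γ), φ (x, x * γ) := by
  rw [← intervalIntegral.integral_of_le hT.le, ← intervalIntegral.integral_of_le (by positivity)]
  have h := intervalIntegral.integral_comp_mul_right (a := 0) (b := T / γ)
    (fun t => φ (t / γ, t)) hγ.ne'
  simp only [mul_div_cancel_right₀ _ hγ.ne', zero_mul, div_mul_cancel₀ _ hγ.ne'] at h
  rw [h, smul_eq_mul, mul_inv_cancel_left₀ hγ.ne']

end TestFunctions

section Superposition

variable {X : Type*} [MeasurableSpace X] {μ : Measure X} {ν : Measure ℝ}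
  [IsFiniteMeasure ν] {h : X → ℝ → ℝ} {C : ℝ} {ψ : X → ℝ}

lemma integrable_superposition_prod (hm : Measurable (Function.uncurry h))
    (hb : ∀ p v, |h p v| ≤ C) (hψ : Integrable ψ μ) :
    Integrable (Function.uncurry fun p v => h p v * ψ p) (μ.prod ν) := by
  have h1 : Integrable (fun q : X × ℝ => ψ q.1) (μ.prod ν) := hψ.comp_fst ν
  exact h1.bdd_mul (c := C) hm.aestronglyMeasurable
    (Filter.Eventually.of_forall fun q => hb q.1 q.2)

lemma integrable_superposition [SFinite μ] (hm : Measurable (Function.uncurry h))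
    (hb : ∀ p v, |h p v| ≤ C) (hψ : Integrable ψ μ) :
    Integrable (fun p => (∫ v, h p v ∂ν) * ψ p) μ := by
  have h2 := (integrable_superposition_prod (ν := ν) hm hb hψ).integral_prod_left
  simpa only [Function.uncurry, integral_mul_const] using h2

lemma integrable_superposition' [SFinite μ] (hm : Measurable (Function.uncurry h))
    (hb : ∀ p v, |h p v| ≤ C) (hψ : Integrable ψ μ) :
    Integrable (fun v => ∫ p, h p v * ψ p ∂μ) ν :=
  (integrable_superposition_prod (ν := ν) hm hb hψ).integral_prod_right

lemma integral_superposition [SFinite μ] (hm : Measurable (Function.uncurry h))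
    (hb : ∀ p v, |h p v| ≤ C) (hψ : Integrable ψ μ) :
    ∫ p, (∫ v, h p v ∂ν) * ψ p ∂μ = ∫ v, ∫ p, h p v * ψ p ∂μ ∂ν := by
  rw [← integral_integral_swap (integrable_superposition_prod hm hb hψ)]
  simp only [integral_mul_const]

end Superposition

section TransportIdentity

variable {φ : ℝ × ℝ → ℝ} {T C q₀ : ℝ} {ν : Measure ℝ} [IsFiniteMeasure ν] {A B g e : ℝ → ℝ}

lemma integrable_const_in_time_mul {ψ : ℝ × ℝ → ℝ} {μ : Measure (ℝ × ℝ)} (hψ : Integrable ψ μ)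
    (he : Measurable e) (hb : ∀ x, |e x| ≤ C) : Integrable (fun p => e p.1 * ψ p) μ :=
  hψ.bdd_mul (c := C) (he.comp measurable_fst).aestronglyMeasurable
    (Filter.Eventually.of_forall fun q => hb q.1)

lemma measurable_mul_front {α : Type*} [MeasurableSpace α] {x t : α → ℝ} (hA : Measurable A)
    (hg : Measurable g) (hx : Measurable x) (ht : Measurable t) :
    Measurable (Function.uncurry fun (p : α) v => A v * front (g v) (x p) (t p)) :=
  (hA.comp measurable_snd).mul (measurable_front (hg.comp measurable_snd)
    (hx.comp measurable_fst) (ht.comp measurable_fst))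

lemma abs_mul_front_le (hb : ∀ v, |A v| ≤ C) (v γ x t : ℝ) : |A v * front γ x t| ≤ C := by
  rw [abs_mul]
  calc |A v| * |front γ x t| ≤ |A v| * 1 :=
        mul_le_mul_of_nonneg_left (abs_front_le _ _ _) (abs_nonneg _)
    _ ≤ C := by rw [mul_one]; exact hb v

lemma integrable_front_superposition {ψ : ℝ × ℝ → ℝ} {μ : Measure (ℝ × ℝ)} [SFinite μ]
    (hψ : Integrable ψ μ) (hA : Measurable A) (hAb : ∀ v, |A v| ≤ C) (hg : Measurable g) :
    Integrable (fun p => (∫ v, A v * front (g v) p.1 p.2 ∂ν) * ψ p) μ :=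
  integrable_superposition (h := fun p v => A v * front (g v) p.1 p.2)
    (measurable_mul_front hA hg measurable_fst measurable_snd)
    (fun _ v => abs_mul_front_le hAb v _ _ _) hψ

/-- For a stationary density there is only the exchange between the initial and the final time. -/
lemma integral_stationary_mul_dt (hφ : ContDiff ℝ 1 φ) (hc : HasCompactSupport φ) (hT : 0 < T)
    (he : Measurable e) (heb : ∀ x, |e x| ≤ C) :
    ∫ p in univ ×ˢ Ioc 0 T, e p.1 * dt φ p.1 p.2 =
      (∫ x, e x * φ (x, T)) - ∫ x, e x * φ (x, 0) := by
  have hi := integrable_const_in_time_mul ((integrable_dt hφ hc).integrableOn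
    (s := univ ×ˢ Ioc 0 T)) he heb
  rw [Measure.volume_eq_prod] at hi ⊢
  rw [setIntegral_prod _ hi, setIntegral_univ, ← integral_sub]
  · refine integral_congr_ae (Filter.Eventually.of_forall fun x => ?_)
    simp only [integral_const_mul, setIntegral_Ioc_dt hφ x hT.le]
    ring
  · exact (integrable_slice hφ hc T).bdd_mul (c := C) he.aestronglyMeasurable
      (Filter.Eventually.of_forall heb)
  · exact (integrable_slice hφ hc 0).bdd_mul (c := C) he.aestronglyMeasurable
      (Filter.Eventually.of_forall heb)

lemma integral_strip_dx (hφ : ContDiff ℝ 1 φ) (hc : HasCompactSupport φ) :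
    ∫ p in univ ×ˢ Ioc 0 T, dx φ p.1 p.2 = 0 := by
  have hi := (integrable_dx hφ hc)
  rw [Measure.volume_eq_prod] at hi ⊢
  rw [← Measure.prod_restrict, Measure.restrict_univ, integral_prod_symm]
  · simp [integral_dx hφ hc]
  · have := hi.integrableOn (s := univ ×ˢ Ioc 0 T)
    rwa [IntegrableOn, ← Measure.prod_restrict, Measure.restrict_univ] at this

lemma integral_strip_front_mul_dt (hφ : ContDiff ℝ 1 φ) (hc : HasCompactSupport φ) (hT : 0 < T)
    {γ : ℝ} (hγ : 0 < γ) :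
    ∫ p in univ ×ˢ Ioc 0 T, front γ p.1 p.2 * dt φ p.1 p.2 =
      (∫ x, front γ x T * φ (x, T)) - (∫ x, front γ x 0 * φ (x, 0)) -
        ∫ x in Ioc 0 (T / γ), φ (x, x * γ) := by
  have hi : IntegrableOn (fun p : ℝ × ℝ => front γ p.1 p.2 * dt φ p.1 p.2) (univ ×ˢ Ioc 0 T) :=
    ((integrable_dt hφ hc).integrableOn (s := univ ×ˢ Ioc 0 T)).bdd_mul (c := 1)
      (measurable_front measurable_const measurable_fst measurable_snd).aestronglyMeasurable
      (Filter.Eventually.of_forall fun q => abs_front_le _ _ _)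
  have hs : ∀ t, Integrable fun x => front γ x t * φ (x, t) := fun t =>
    (integrable_slice hφ hc t).bdd_mul (c := 1)
      (measurable_front measurable_const measurable_id measurable_const).aestronglyMeasurable
      (Filter.Eventually.of_forall fun q => abs_front_le _ _ _)
  have hJ : IntegrableOn (fun x => φ (x, x * γ)) (Ioc 0 (T / γ)) :=
    (hφ.continuous.comp (by fun_prop : Continuous fun x : ℝ => (x, x * γ))).integrableOn_Ioc
  rw [Measure.volume_eq_prod] at hi ⊢
  rw [setIntegral_prod _ hi, setIntegral_univ]
  simp only [integral_front_mul_dt hφ hγ hT]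
  have hs2 : Integrable fun x => front γ x T * φ (x, T) - front γ x 0 * φ (x, 0) :=
    (hs T).sub (hs 0)
  rw [integral_sub hs2 (hJ.integrable_indicator measurableSet_Ioc),
    integral_sub (hs T) (hs 0), integral_indicator measurableSet_Ioc]

lemma integral_strip_front_mul_dx (hφ : ContDiff ℝ 1 φ) (hc : HasCompactSupport φ) (hT : 0 < T)
    {γ : ℝ} (hγ : 0 < γ) :
    ∫ p in univ ×ˢ Ioc 0 T, front γ p.1 p.2 * dx φ p.1 p.2 =
      γ * ∫ x in Ioc 0 (T / γ), φ (x, x * γ) := by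
  have hi : IntegrableOn (fun p : ℝ × ℝ => front γ p.1 p.2 * dx φ p.1 p.2) (univ ×ˢ Ioc 0 T) :=
    ((integrable_dx hφ hc).integrableOn (s := univ ×ˢ Ioc 0 T)).bdd_mul (c := 1)
      (measurable_front measurable_const measurable_fst measurable_snd).aestronglyMeasurable
      (Filter.Eventually.of_forall fun q => abs_front_le _ _ _)
  rw [Measure.volume_eq_prod] at hi ⊢
  rw [IntegrableOn, ← Measure.prod_restrict, Measure.restrict_univ] at hi
  rw [← Measure.prod_restrict, Measure.restrict_univ, integral_prod_symm _ hi,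
    ← integral_along_front hγ hT]
  simp only [integral_front_mul_dx hφ hc hγ]

/-- Weak form of `E_t + Q_x` for superpositions `E = e(x) + ∫ A(v) H_v dν(v)` and
`Q = q₀ + ∫ B(v) H_v dν(v)` of fronts `H_v` of speed `1 / g(v)`: the only contributions are the
boundary values of `E` and the production `B(v) g(v) - A(v)` along each front, which is the
Rankine-Hugoniot deficit of that front. -/
theorem integral_superposed_fronts (hφ : ContDiff ℝ 1 φ) (hc : HasCompactSupport φ) (hT : 0 < T)
    (hA : Measurable A) (hAb : ∀ v, |A v| ≤ C) (hB : Measurable B) (hBb : ∀ v, |B v| ≤ C)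
    (hg : Measurable g) (hg1 : ∀ v, 1 ≤ g v) (he : Measurable e) (heb : ∀ x, |e x| ≤ C) :
    ∫ p in univ ×ˢ Ioc 0 T, ((e p.1 + ∫ v, A v * front (g v) p.1 p.2 ∂ν) * dt φ p.1 p.2 +
        (q₀ + ∫ v, B v * front (g v) p.1 p.2 ∂ν) * dx φ p.1 p.2) =
      (∫ x, (e x + ∫ v, A v * front (g v) x T ∂ν) * φ (x, T)) -
        (∫ x, (e x + ∫ v, A v * front (g v) x 0 ∂ν) * φ (x, 0)) +
        ∫ v, (B v * g v - A v) * (∫ x in Ioc 0 (T / g v), φ (x, x * g v)) ∂ν := by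
  have hg0 : ∀ v, 0 < g v := fun v => one_pos.trans_le (hg1 v)
  have hdt := (integrable_dt hφ hc).integrableOn (s := univ ×ˢ Ioc 0 T)
  have hdx := (integrable_dx hφ hc).integrableOn (s := univ ×ˢ Ioc 0 T)
  have h1 := integrable_const_in_time_mul hdt he heb
  have h2 := integrable_front_superposition (ν := ν) hdt hA hAb hg
  have h3 := hdx.const_mul q₀
  have h4 := integrable_front_superposition (ν := ν) hdx hB hBb hg
  have hS : ∀ t, Integrable (fun x => e x * φ (x, t)) := fun t =>
    (integrable_slice hφ hc t).bdd_mul (c := C) he.aestronglyMeasurable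
      (Filter.Eventually.of_forall heb)
  have hmA : ∀ t : ℝ, Measurable
      (Function.uncurry fun (x : ℝ) v => A v * front (g v) x t) := fun t =>
    measurable_mul_front hA hg measurable_id measurable_const
  have hSA : ∀ t, Integrable (fun x => (∫ v, A v * front (g v) x t ∂ν) * φ (x, t)) := fun t =>
    integrable_superposition (hmA t) (fun _ v => abs_mul_front_le hAb v _ _ _)
      (integrable_slice hφ hc t)
  have hSA' : ∀ t, Integrable (fun v => ∫ x, A v * front (g v) x t * φ (x, t)) ν := fun t =>
    integrable_superposition' (hmA t) (fun _ v => abs_mul_front_le hAb v _ _ _)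
      (integrable_slice hφ hc t)
  have hmA2 : Measurable (Function.uncurry fun (p : ℝ × ℝ) v => A v * front (g v) p.1 p.2) :=
    measurable_mul_front hA hg measurable_fst measurable_snd
  have hmB2 : Measurable (Function.uncurry fun (p : ℝ × ℝ) v => B v * front (g v) p.1 p.2) :=
    measurable_mul_front hB hg measurable_fst measurable_snd
  have hIA : ∫ p in univ ×ˢ Ioc 0 T, (∫ v, A v * front (g v) p.1 p.2 ∂ν) * dt φ p.1 p.2 =
      ∫ v, ((∫ x, A v * front (g v) x T * φ (x, T)) - (∫ x, A v * front (g v) x 0 * φ (x, 0)) -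
        A v * ∫ x in Ioc 0 (T / g v), φ (x, x * g v)) ∂ν := by
    rw [integral_superposition hmA2 (fun _ v => abs_mul_front_le hAb v _ _ _) hdt]
    refine integral_congr_ae (Filter.Eventually.of_forall fun v => ?_)
    simp only [mul_assoc, integral_const_mul, integral_strip_front_mul_dt hφ hc hT (hg0 v)]
    ring
  have hIB : ∫ p in univ ×ˢ Ioc 0 T, (∫ v, B v * front (g v) p.1 p.2 ∂ν) * dx φ p.1 p.2 =
      ∫ v, B v * g v * (∫ x in Ioc 0 (T / g v), φ (x, x * g v)) ∂ν := by
    rw [integral_superposition hmB2 (fun _ v => abs_mul_front_le hBb v _ _ _) hdx]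
    refine integral_congr_ae (Filter.Eventually.of_forall fun v => ?_)
    simp only [mul_assoc, integral_const_mul, integral_strip_front_mul_dx hφ hc hT (hg0 v)]
  -- The production terms are integrable because both sides of the two identities above are.
  have hJA : Integrable (fun v => A v * ∫ x in Ioc 0 (T / g v), φ (x, x * g v)) ν := by
    have h := ((hSA' T).sub (hSA' 0)).sub (integrable_superposition' (ν := ν) hmA2
      (fun _ v => abs_mul_front_le hAb v _ _ _) hdt)
    refine h.congr (Filter.Eventually.of_forall fun v => ?_)
    simp only [Pi.sub_apply, mul_assoc, integral_const_mul,
      integral_strip_front_mul_dt hφ hc hT (hg0 v)]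
    ring
  have hJB : Integrable (fun v => B v * g v * ∫ x in Ioc 0 (T / g v), φ (x, x * g v)) ν := by
    refine (integrable_superposition' (ν := ν) hmB2
      (fun _ v => abs_mul_front_le hBb v _ _ _) hdx).congr
      (Filter.Eventually.of_forall fun v => ?_)
    simp only [mul_assoc, integral_const_mul, integral_strip_front_mul_dx hφ hc hT (hg0 v)]
  have hsum : ∀ t, ∫ x, (e x + ∫ v, A v * front (g v) x t ∂ν) * φ (x, t) =
      (∫ x, e x * φ (x, t)) + ∫ v, (∫ x, A v * front (g v) x t * φ (x, t)) ∂ν := by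
    intro t
    rw [← integral_superposition (hmA t) (fun _ v => abs_mul_front_le hAb v _ _ _)
      (integrable_slice hφ hc t), ← integral_add (hS t) (hSA t)]
    simp only [add_mul]
  have hprod : ∫ v, (B v * g v - A v) * (∫ x in Ioc 0 (T / g v), φ (x, x * g v)) ∂ν =
      (∫ v, B v * g v * (∫ x in Ioc 0 (T / g v), φ (x, x * g v)) ∂ν) -
        ∫ v, A v * (∫ x in Ioc 0 (T / g v), φ (x, x * g v)) ∂ν := by
    rw [← integral_sub hJB hJA]; simp only [sub_mul]
  rw [hsum, hsum, hprod, ← hIB]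
  have hSA2 : Integrable (fun v => (∫ x, A v * front (g v) x T * φ (x, T)) -
      ∫ x, A v * front (g v) x 0 * φ (x, 0)) ν := (hSA' T).sub (hSA' 0)
  rw [integral_sub hSA2 hJA, integral_sub (hSA' T) (hSA' 0)] at hIA
  have hsplit : ∫ p in univ ×ˢ Ioc 0 T, ((e p.1 + ∫ v, A v * front (g v) p.1 p.2 ∂ν) *
      dt φ p.1 p.2 + (q₀ + ∫ v, B v * front (g v) p.1 p.2 ∂ν) * dx φ p.1 p.2) =
      ((∫ p in univ ×ˢ Ioc 0 T, e p.1 * dt φ p.1 p.2) +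
        ∫ p in univ ×ˢ Ioc 0 T, (∫ v, A v * front (g v) p.1 p.2 ∂ν) * dt φ p.1 p.2) +
      ((∫ p in univ ×ˢ Ioc 0 T, q₀ * dx φ p.1 p.2) +
        ∫ p in univ ×ˢ Ioc 0 T, (∫ v, B v * front (g v) p.1 p.2 ∂ν) * dx φ p.1 p.2) := by
    rw [← integral_add h1 h2, ← integral_add h3 h4]
    refine Eq.trans ?_ (integral_add (h1.add h2) (h3.add h4))
    simp only [add_mul]
  rw [hsplit, hIA, integral_stationary_mul_dt hφ hc hT he heb, integral_const_mul,
    integral_strip_dx hφ hc]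
  ring

lemma integrableOn_superposed_fronts {S : Set (ℝ × ℝ)} (hφ : ContDiff ℝ 1 φ)
    (hc : HasCompactSupport φ)
    (hA : Measurable A) (hAb : ∀ v, |A v| ≤ C) (hB : Measurable B) (hBb : ∀ v, |B v| ≤ C)
    (hg : Measurable g) (he : Measurable e) (heb : ∀ x, |e x| ≤ C) :
    IntegrableOn (fun p : ℝ × ℝ => (e p.1 + ∫ v, A v * front (g v) p.1 p.2 ∂ν) * dt φ p.1 p.2 +
        (q₀ + ∫ v, B v * front (g v) p.1 p.2 ∂ν) * dx φ p.1 p.2) S := by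
  have hdt := integrable_dt hφ hc
  have hdx := integrable_dx hφ hc
  have := ((integrable_const_in_time_mul hdt he heb).add
    (integrable_front_superposition (ν := ν) hdt hA hAb hg)).add
    ((hdx.const_mul q₀).add (integrable_front_superposition (ν := ν) hdx hB hBb hg))
  refine Integrable.integrableOn ?_
  refine this.congr (Filter.Eventually.of_forall fun p => ?_)
  simp only [Pi.add_apply]; ring

end TransportIdentity

/-! ### Configurations and the lower edge of the relays in state `-1` -/

/-- What the argument retains of the configurations generated from the virgin state: they are
Borel, take the values `±1`, and raising the thresholds of a relay in state `-1` does not change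
its state. -/
structure IsConfig (z : ℝ × ℝ → ℝ) : Prop where
  measurable : Measurable fun ρ : plane => z ρ
  values : ∀ ρ ∈ plane, z ρ = 1 ∨ z ρ = -1
  antitone : ∀ ρ ∈ plane, ∀ ρ' ∈ plane, ρ ≤ ρ' → z ρ = -1 → z ρ' = -1

lemma relay_eq_or (ρ : ℝ × ℝ) (u : ℝ → ℝ) (z₀ t : ℝ) :
    relay ρ u z₀ t = 1 ∨ relay ρ u z₀ t = -1 ∨ relay ρ u z₀ t = z₀ := by
  unfold relay; split_ifs <;> simp

lemma IsGeneratedBy.isConfig {T : ℝ} {u : ℝ → ℝ} {z : ℝ × ℝ → ℝ}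
    (hm : Measurable fun ρ : plane => z ρ) (h : IsGeneratedBy T u z) : IsConfig z := by
  obtain ⟨zv, hv, -, hz⟩ := h
  refine ⟨hm, fun ρ hρ => ?_, fun ρ hρ ρ' hρ' hle hneg => ?_⟩
  · rw [hz ρ hρ]
    rcases relay_eq_or ρ u (zv ρ) T with h | h | h
    · exact Or.inl h
    · exact Or.inr h
    · rw [h]; exact (hv ρ hρ).1
  · rcases eq_or_ne ρ ρ' with rfl | hne
    · exact hneg
    rw [hz ρ hρ] at hneg
    rw [hz ρ' hρ']
    obtain ⟨hle1, hle2⟩ := hle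
    have hlt : ρ.1 + ρ.2 < ρ'.1 + ρ'.2 := by
      by_contra hcon
      exact hne (Prod.ext (by linarith) (by linarith))
    unfold relay at hneg ⊢
    have hnot : ¬ ∃ s ∈ Icc 0 T, ρ'.2 ≤ u s ∧ ∀ r ∈ Icc s T, ρ'.1 < u r := by
      rintro ⟨s, hs, h2, h1⟩
      rw [if_pos ⟨s, hs, hle2.trans h2, fun r hr => hle1.trans_lt (h1 r hr)⟩] at hneg
      norm_num at hneg
    rw [if_neg hnot]
    split_ifs with hlow
    · rfl
    · split_ifs at hneg with hup' hlow'
      · norm_num at hneg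
      · obtain ⟨s, hs, h1, h2⟩ := hlow'
        exact absurd ⟨s, hs, h1.trans hle1, fun r hr => (h2 r hr).trans_le hle2⟩ hlow
      · -- No threshold was reached, so that both relays are still in the virgin state.
        refine (hv ρ' hρ').2.1 ?_
        by_contra hcon
        have := (hv ρ hρ).2.2 (by linarith)
        rw [this] at hneg; norm_num at hneg

lemma isConfig_of_mem_states {T : ℝ} {z : ℝ × ℝ → ℝ} (h : z ∈ states T) : IsConfig z := by
  obtain ⟨hm, u, -, hu⟩ := h; exact hu.isConfig hm

lemma isConfig_of_mem_statesLip {T : ℝ} {L : ℝ≥0} {z : ℝ × ℝ → ℝ} (h : z ∈ statesLip T L) :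
    IsConfig z := by
  obtain ⟨hm, u, -, hu⟩ := h; exact hu.isConfig hm

lemma triangle_subset_plane (a : ℝ) : triangle a ⊆ plane := fun _ h => h.2.1

lemma measurableSet_plane : MeasurableSet plane :=
  measurableSet_lt measurable_fst measurable_snd

lemma measurableSet_triangle (a : ℝ) : MeasurableSet (triangle a) := by
  have h : triangle a = {ρ | -a ≤ ρ.1} ∩ ({ρ | ρ.1 < ρ.2} ∩ {ρ | ρ.2 ≤ a}) := by
    ext; simp [triangle]
  rw [h]
  exact (measurableSet_le measurable_const measurable_fst).inter
    (measurableSet_plane.inter (measurableSet_le measurable_snd measurable_const))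

lemma triangle_subset_Icc (a : ℝ) : triangle a ⊆ Icc (-a) a ×ˢ Icc (-a) a := fun _ h =>
  ⟨⟨h.1, h.2.1.le.trans h.2.2⟩, ⟨h.1.trans h.2.1.le, h.2.2⟩⟩

lemma volume_triangle_lt_top (a : ℝ) : volume (triangle a) < ⊤ :=
  (measure_mono (triangle_subset_Icc a)).trans_lt
    (isCompact_Icc.prod isCompact_Icc).measure_lt_top

instance isFiniteMeasure_restrict_triangle (a : ℝ) :
    IsFiniteMeasure (volume.restrict (triangle a)) :=
  ⟨by simpa using volume_triangle_lt_top a⟩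

variable {a k : ℝ} {z : ℝ × ℝ → ℝ}

lemma IsConfig.measurable_indicator (hz : IsConfig z) : Measurable (plane.indicator z) := by
  refine measurable_of_restrict_of_restrict_compl measurableSet_plane ?_ ?_
  · have h : plane.domRestrict (plane.indicator z) = fun ρ : plane => z ρ :=
      funext fun ρ => indicator_of_mem ρ.2 z
    rw [h]; exact hz.measurable
  · have h : planeᶜ.domRestrict (plane.indicator z) = fun _ => 0 :=
      funext fun ρ => indicator_of_notMem ρ.2 z
    rw [h]; exact measurable_const

lemma IsConfig.abs_eq (hz : IsConfig z) {ρ : ℝ × ℝ} (hρ : ρ ∈ plane) : |z ρ| = 1 := by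
  rcases hz.values ρ hρ with h | h <;> simp [h]

lemma IsConfig.aestronglyMeasurable (hz : IsConfig z) :
    AEStronglyMeasurable z (volume.restrict (triangle a)) := by
  refine hz.measurable_indicator.aestronglyMeasurable.congr ?_
  filter_upwards [ae_restrict_mem (measurableSet_triangle a)] with ρ hρ
  exact indicator_of_mem (triangle_subset_plane a hρ) _

lemma IsConfig.integrableOn (hz : IsConfig z) : IntegrableOn z (triangle a) := by
  refine Integrable.of_bound hz.aestronglyMeasurable 1 ?_
  filter_upwards [ae_restrict_mem (measurableSet_triangle a)] with ρ hρ
  rw [Real.norm_eq_abs, hz.abs_eq (triangle_subset_plane a hρ)]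

lemma IsConfig.measurableSet_neg (hz : IsConfig z) :
    MeasurableSet {ρ | ρ ∈ triangle a ∧ z ρ = -1} := by
  have h : {ρ | ρ ∈ triangle a ∧ z ρ = -1} =
      triangle a ∩ (plane.indicator z) ⁻¹' {-1} := by
    ext ρ
    simp only [mem_ofPred_eq, mem_inter_iff, mem_preimage, mem_singleton_iff]
    refine and_congr_right fun hρ => ?_
    rw [indicator_of_mem (triangle_subset_plane a hρ)]
  rw [h]
  exact (measurableSet_triangle a).inter (hz.measurable_indicator (measurableSet_singleton _))

lemma neg_slice_subset (v : ℝ) : {r : ℝ | (r, v) ∈ triangle a ∧ z (r, v) = -1} ⊆ Ico (-a) v :=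
  fun _ h => ⟨h.1.1, h.1.2.1⟩

lemma neg_slice_ne_top (v : ℝ) : volume {r : ℝ | (r, v) ∈ triangle a ∧ z (r, v) = -1} ≠ ⊤ :=
  ((measure_mono (neg_slice_subset v)).trans_lt measure_Ico_lt_top).ne

lemma horizLength_nonneg (v : ℝ) : 0 ≤ horizLength a z v := ENNReal.toReal_nonneg

lemma horizLength_le {v : ℝ} (hv : -a ≤ v) : horizLength a z v ≤ v + a := by
  have h := ENNReal.toReal_mono (measure_Ico_lt_top).ne
    (measure_mono (μ := volume) (neg_slice_subset (a := a) (z := z) v))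
  rw [Real.volume_Ico, ENNReal.toReal_ofReal (by linarith)] at h
  unfold horizLength; linarith

lemma horizLength_le_two_mul (ha : 0 < a) (v : ℝ) : horizLength a z v ≤ 2 * a := by
  have hsub : {r : ℝ | (r, v) ∈ triangle a ∧ z (r, v) = -1} ⊆ Icc (-a) a :=
    fun r h => ⟨h.1.1, h.1.2.1.le.trans h.1.2.2⟩
  have h := ENNReal.toReal_mono (measure_Icc_lt_top).ne (measure_mono (μ := volume) hsub)
  rw [Real.volume_Icc, ENNReal.toReal_ofReal (by linarith)] at h
  unfold horizLength; linarith

lemma IsConfig.measurable_gUp (hz : IsConfig z) : Measurable (gUp a z) := by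
  unfold gUp horizLength
  have h := measurable_measure_prodMk_right (μ := (volume : Measure ℝ))
    (hz.measurableSet_neg (a := a))
  exact (h.ennreal_toReal.const_mul 2).const_add 1

lemma one_le_gUp (v : ℝ) : 1 ≤ gUp a z v := by
  have := horizLength_nonneg (a := a) (z := z) v
  unfold gUp; linarith

/-- Left end point of the horizontal segment at height `v` of the relays in state `-1`, computed
from the length of that segment, whose right end point is `v`; it is `v` if there are none. -/
noncomputable def lowerEdge (a : ℝ) (z : ℝ × ℝ → ℝ) (v : ℝ) : ℝ := v - horizLength a z v

lemma gUp_eq (v : ℝ) : gUp a z v = 1 + 2 * (v - lowerEdge a z v) := by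
  unfold gUp lowerEdge; ring

lemma neg_le_lowerEdge {v : ℝ} (hv : -a ≤ v) : -a ≤ lowerEdge a z v := by
  have := horizLength_le (z := z) hv
  unfold lowerEdge; linarith

lemma lowerEdge_le_self (v : ℝ) : lowerEdge a z v ≤ v := by
  have := horizLength_nonneg (a := a) (z := z) v
  unfold lowerEdge; linarith

lemma IsConfig.lowerEdge_le (hz : IsConfig z) {r v : ℝ} (h : (r, v) ∈ triangle a)
    (hr : z (r, v) = -1) : lowerEdge a z v ≤ r := by
  have hsub : Ico r v ⊆ {s : ℝ | (s, v) ∈ triangle a ∧ z (s, v) = -1} := fun s hs =>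
    ⟨⟨h.1.trans hs.1, hs.2, h.2.2⟩,
      hz.antitone (r, v) h.2.1 (s, v) hs.2 ⟨hs.1, le_rfl⟩ hr⟩
  have h1 := ENNReal.toReal_mono (neg_slice_ne_top v) (measure_mono (μ := volume) hsub)
  rw [Real.volume_Ico, ENNReal.toReal_ofReal (by linarith [h.2.1])] at h1
  unfold lowerEdge horizLength; linarith

lemma IsConfig.eq_neg_one_of_lowerEdge_lt (hz : IsConfig z) {r v : ℝ} (h : (r, v) ∈ triangle a)
    (hr : lowerEdge a z v < r) : z (r, v) = -1 := by
  by_contra hne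
  have hsub : {s : ℝ | (s, v) ∈ triangle a ∧ z (s, v) = -1} ⊆ Ico r v := fun s hs => by
    refine ⟨le_of_not_gt fun hsr => hne ?_, hs.1.2.1⟩
    exact hz.antitone (s, v) hs.1.2.1 (r, v) h.2.1 ⟨hsr.le, le_rfl⟩ hs.2
  have h1 := ENNReal.toReal_mono (measure_Ico_lt_top).ne (measure_mono (μ := volume) hsub)
  rw [Real.volume_Ico, ENNReal.toReal_ofReal (by linarith [h.2.1])] at h1
  unfold lowerEdge horizLength at hr; linarith

/-- Relays whose thresholds lie above the input are in state `-1`: compatibility yields this for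
almost all of them, and the monotonicity of the configuration for all. -/
lemma IsConfig.eq_neg_one_of_compatible (hz : IsConfig z) (hc : Compatible a k z) (hk : -a ≤ k)
    {r v : ℝ} (hkr : k < r) (hrv : r < v) (hv : v ≤ a) : z (r, v) = -1 := by
  by_contra hne
  have hsub : Ioo k r ×ˢ Ioo r v ⊆ triangle a := fun ρ hρ =>
    ⟨hk.trans hρ.1.1.le, hρ.1.2.trans hρ.2.1, hρ.2.2.le.trans hv⟩
  have h0 : volume.restrict (triangle a) (Ioo k r ×ˢ Ioo r v) = 0 := by
    refine measure_mono_null ?_ (ae_iff.1 hc)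
    rintro ⟨s, w⟩ ⟨hs, hw⟩ hreg
    rcases hreg with ⟨h1, -⟩ | ⟨-, h2⟩
    · exact hs.1.not_gt h1
    · exact hne (hz.antitone (s, w) (hs.2.trans hw.1) (r, v) hrv ⟨hs.2.le, hw.2.le⟩ h2)
  rw [Measure.restrict_apply (measurableSet_Ioo.prod measurableSet_Ioo),
    inter_eq_self_of_subset_left hsub] at h0
  exact ((isOpen_Ioo.prod isOpen_Ioo).measure_pos volume
    ((nonempty_Ioo.2 hkr).prod (nonempty_Ioo.2 hrv))).ne' h0

lemma IsConfig.lowerEdge_le_input (hz : IsConfig z) (hc : Compatible a k z) (hk : -a ≤ k)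
    {v : ℝ} (hv : v ≤ a) : lowerEdge a z v ≤ k := by
  refine le_of_forall_gt_imp_ge_of_dense fun r hr => ?_
  rcases lt_or_ge r v with hrv | hrv
  · exact hz.lowerEdge_le ⟨hk.trans hr.le, hrv, hv⟩ (hz.eq_neg_one_of_compatible hc hk hr hrv hv)
  · exact (lowerEdge_le_self v).trans hrv

lemma IsConfig.lowerEdge_antitone (hz : IsConfig z) (hc : Compatible a k z) (hk : -a ≤ k)
    {v w : ℝ} (hkv : k ≤ v) (hvw : v < w) (hw : w ≤ a) : lowerEdge a z w ≤ lowerEdge a z v := by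
  refine le_of_forall_gt_imp_ge_of_dense fun r hr => ?_
  rcases lt_or_ge r v with hrv | hrv
  · have hr' : -a ≤ r := (neg_le_lowerEdge (hk.trans hkv)).trans hr.le
    refine hz.lowerEdge_le ⟨hr', hrv.trans hvw, hw⟩ (hz.antitone (r, v) hrv (r, w)
      (hrv.trans hvw) ⟨le_rfl, hvw.le⟩ (hz.eq_neg_one_of_lowerEdge_lt
        ⟨hr', hrv, hvw.le.trans hw⟩ hr))
  · exact (hz.lowerEdge_le_input hc hk hw).trans (hkv.trans hrv)

/-- The coefficient `g` grows at least with slope `2`. -/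
lemma IsConfig.gUp_add_le (hz : IsConfig z) (hc : Compatible a k z) (hk : -a ≤ k)
    {v w : ℝ} (hkv : k ≤ v) (hvw : v ≤ w) (hw : w ≤ a) :
    gUp a z v + 2 * (w - v) ≤ gUp a z w := by
  rcases hvw.eq_or_lt with rfl | hvw
  · simp
  have := hz.lowerEdge_antitone hc hk hkv hvw hw
  rw [gUp_eq, gUp_eq]; linarith

/-- The lower edge runs along the graph, unless it lies on the boundary of the triangle. -/
lemma IsConfig.lowerEdge_mem_graph (hz : IsConfig z) {v : ℝ} (hv : v ≤ a)
    (h1 : -a < lowerEdge a z v) (h2 : lowerEdge a z v < v) :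
    (lowerEdge a z v, v) ∈ graph z ∩ triangle a := by
  set b := lowerEdge a z v with hb
  have hcont : Continuous fun r : ℝ => (r, v) := by fun_prop
  have hR : ∀ s : Set (ℝ × ℝ), (∀ r ∈ Ioo b v, (r, v) ∈ s) → (b, v) ∈ closure s := by
    intro s hs
    have hb' : b ∈ closure (Ioo b v) := by
      rw [closure_Ioo h2.ne]; exact left_mem_Icc.2 h2.le
    exact map_mem_closure (f := fun r => (r, v)) hcont hb' hs
  have hL : ∀ s : Set (ℝ × ℝ), (∀ r ∈ Ioo (-a) b, (r, v) ∈ s) → (b, v) ∈ closure s := by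
    intro s hs
    have hb' : b ∈ closure (Ioo (-a) b) := by
      rw [closure_Ioo h1.ne]; exact right_mem_Icc.2 h1.le
    exact map_mem_closure (f := fun r => (r, v)) hcont hb' hs
  have hneg : ∀ r ∈ Ioo b v, (r, v) ∈ plane ∧ z (r, v) = -1 := fun r hr =>
    ⟨hr.2, hz.eq_neg_one_of_lowerEdge_lt ⟨h1.le.trans hr.1.le, hr.2, hv⟩ hr.1⟩
  have hpos : ∀ r ∈ Ioo (-a) b, (r, v) ∈ plane ∧ z (r, v) = 1 := fun r hr => by
    have hp : (r, v) ∈ plane := hr.2.trans h2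
    refine ⟨hp, (hz.values _ hp).resolve_right fun h => ?_⟩
    exact (hz.lowerEdge_le ⟨hr.1.le, hp, hv⟩ h).not_gt hr.2
  refine ⟨⟨?_, ?_⟩, h1.le, h2, hv⟩
  · rw [frontier_eq_closure_inter_closure]
    refine ⟨hR _ fun r hr => hneg r hr, hL _ fun r hr h => ?_⟩
    have := (hpos r hr).2.symm.trans h.2; norm_num at this
  · rw [frontier_eq_closure_inter_closure]
    refine ⟨hL _ fun r hr => hpos r hr, hR _ fun r hr h => ?_⟩
    have := (hneg r hr).2.symm.trans h.2; norm_num at this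

/-! ### Finitely many rarefaction waves -/

/-- A finite set cuts an open interval into finitely many open intervals. -/
lemma exists_subdivision (C : Finset ℝ) {α β : ℝ} (hαβ : α < β) :
    ∃ (n : ℕ) (v : ℕ → ℝ), v 0 = α ∧ v (n + 1) = β ∧ (∀ i ≤ n, v i < v (i + 1)) ∧
      ∀ i ≤ n, ∀ y ∈ Ioo (v i) (v (i + 1)), y ∈ Ioo α β ∧ y ∉ C := by
  classical
  set D : Finset ℝ := insert α (insert β (C.filter (· ∈ Ioo α β))) with hD
  have hαD : α ∈ D := by simp [hD]
  have hβD : β ∈ D := by simp [hD]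
  have hDI : ∀ y ∈ D, α ≤ y ∧ y ≤ β := by
    intro y hy
    simp only [hD, Finset.mem_insert, Finset.mem_filter, mem_Ioo] at hy
    rcases hy with rfl | rfl | ⟨-, h1, h2⟩
    · exact ⟨le_rfl, hαβ.le⟩
    · exact ⟨hαβ.le, le_rfl⟩
    · exact ⟨h1.le, h2.le⟩
  obtain ⟨n, hn⟩ : ∃ n, D.card = n + 2 := by
    have : 1 < D.card := Finset.one_lt_card.2 ⟨α, hαD, β, hβD, hαβ.ne⟩
    exact ⟨D.card - 2, by omega⟩
  set e := D.orderEmbOfFin hn with he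
  have hmin : e ⟨0, by omega⟩ = α := by
    rw [he, Finset.orderEmbOfFin_zero hn (by omega)]
    exact le_antisymm (Finset.min'_le _ _ hαD) (Finset.le_min' _ _ _ fun y hy => (hDI y hy).1)
  have hmax : e ⟨n + 1, by omega⟩ = β := by
    have := Finset.orderEmbOfFin_last hn (by omega)
    refine Eq.trans (by rfl) (this.trans ?_)
    exact le_antisymm (Finset.max'_le _ _ _ fun y hy => (hDI y hy).2) (Finset.le_max' _ _ hβD)
  refine ⟨n, fun i => if h : i < n + 2 then e ⟨i, h⟩ else 0, ?_, ?_, ?_, ?_⟩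
  · simpa using hmin
  · simpa using hmax
  · intro i hi
    simp only [show i < n + 2 by omega, show i + 1 < n + 2 by omega, dif_pos]
    exact e.strictMono (Fin.mk_lt_mk.2 (Nat.lt_succ_self i))
  · intro i hi y hy
    simp only [show i < n + 2 by omega, show i + 1 < n + 2 by omega, dif_pos] at hy
    have h1 := (hDI _ (Finset.orderEmbOfFin_mem D hn ⟨i, by omega⟩)).1
    have h2 := (hDI _ (Finset.orderEmbOfFin_mem D hn ⟨i + 1, by omega⟩)).2
    have hyI : y ∈ Ioo α β := ⟨h1.trans_lt hy.1, hy.2.trans_le h2⟩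
    refine ⟨hyI, fun hyC => ?_⟩
    have hyD : y ∈ D := by simp [hD, hyC, hyI.1, hyI.2]
    have : y ∈ Set.range e := by rw [he, Finset.range_orderEmbOfFin]; exact hyD
    obtain ⟨j, rfl⟩ := this
    have h3 := e.lt_iff_lt.1 hy.1
    have h4 := e.lt_iff_lt.1 hy.2
    rw [Fin.lt_def] at h3 h4
    simp only at h3 h4
    omega

/-- An antitone function that lies on the antidiagonal, except where its graph follows finitely
many horizontal and vertical lines, consists of finitely many constant and antidiagonal pieces. -/
lemma exists_subdivision_of_antitone {b : ℝ → ℝ} {α β : ℝ} (hαβ : α < β)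
    (hb : ∀ v ∈ Ioo α β, ∀ w ∈ Ioo α β, v < w → b w ≤ b v) {H V : Finset ℝ}
    (h : ∀ v ∈ Ioo α β, b v = -v ∨ v ∈ H ∨ b v ∈ V) :
    ∃ (n : ℕ) (v : ℕ → ℝ), v 0 = α ∧ v (n + 1) = β ∧ (∀ i ≤ n, v i < v (i + 1)) ∧
      ∀ i ≤ n, (∀ y ∈ Ioo (v i) (v (i + 1)), y ∈ Ioo α β) ∧
        ((∃ p, ∀ y ∈ Ioo (v i) (v (i + 1)), b y = p) ∨
          ∀ y ∈ Ioo (v i) (v (i + 1)), b y = -y) := by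
  classical
  set S : ℝ → Set ℝ := fun p => {v | v ∈ Ioo α β ∧ b v = p} with hS
  have hSa : ∀ p, BddAbove (S p) := fun p => ⟨β, fun v hv => hv.1.2.le⟩
  have hSb : ∀ p, BddBelow (S p) := fun p => ⟨α, fun v hv => hv.1.1.le⟩
  obtain ⟨n, v, hv0, hvn, hlt, hcut⟩ := exists_subdivision
    (H ∪ (V.image (fun p => sSup (S p)) ∪ V.image (fun p => sInf (S p)))) hαβ
  refine ⟨n, v, hv0, hvn, hlt, fun i hi => ⟨fun y hy => (hcut i hi y hy).1, ?_⟩⟩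
  have hnot : ∀ y ∈ Ioo (v i) (v (i + 1)), y ∉ H ∧ ∀ p ∈ V, sSup (S p) ≠ y ∧ sInf (S p) ≠ y := by
    intro y hy
    have := (hcut i hi y hy).2
    simp only [Finset.mem_union, Finset.mem_image, not_or, not_exists, not_and] at this
    exact ⟨this.1, fun p hp => ⟨this.2.1 p hp, this.2.2 p hp⟩⟩
  by_cases hex : ∃ y ∈ Ioo (v i) (v (i + 1)), b y ∈ V
  · obtain ⟨y, hy, hyV⟩ := hex
    left
    refine ⟨b y, fun w hw => ?_⟩
    have hyI := (hcut i hi y hy).1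
    have hwI := (hcut i hi w hw).1
    have hyS : y ∈ S (b y) := ⟨hyI, rfl⟩
    rcases lt_trichotomy w y with hwy | rfl | hwy
    · -- The infimum of the level set of `b y` is a cut point, hence not in `(v i, v (i + 1))`.
      have h1 : sInf (S (b y)) < w := by
        by_contra hcon
        exact ((hnot (sInf (S (b y))) ⟨hw.1.trans_le (not_lt.1 hcon),
          (csInf_le (hSb _) hyS).trans_lt hy.2⟩).2 _ hyV).2 rfl
      obtain ⟨s, hs, hsw⟩ := exists_lt_of_csInf_lt ⟨y, hyS⟩ h1
      exact le_antisymm ((hb s hs.1 w hwI hsw).trans hs.2.le) (hb w hwI y hyI hwy)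
    · rfl
    · have h1 : w < sSup (S (b y)) := by
        by_contra hcon
        exact ((hnot (sSup (S (b y))) ⟨hy.1.trans_le (le_csSup (hSa _) hyS),
          (not_lt.1 hcon).trans_lt hw.2⟩).2 _ hyV).1 rfl
      obtain ⟨s, hs, hsw⟩ := exists_lt_of_lt_csSup ⟨y, hyS⟩ h1
      exact le_antisymm (hb y hyI w hwI hwy) (hs.2.ge.trans (hb w hwI s hs.1 hsw))
  · right
    intro y hy
    rcases h y (hcut i hi y hy).1 with h1 | h1 | h1
    · exact h1
    · exact absurd h1 (hnot y hy).1
    · exact absurd ⟨y, hy, h1⟩ hex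

lemma one_div_le_div_iff' {x t G : ℝ} (hx : 0 < x) (ht : 0 < t) (hG : 0 < G) :
    1 / G ≤ x / t ↔ t / x ≤ G := by
  rw [one_div_le hG (div_pos hx ht), one_div_div]

lemma div_le_one_div_iff' {x t G : ℝ} (hx : 0 < x) (ht : 0 < t) (hG : 0 < G) :
    x / t ≤ 1 / G ↔ G ≤ t / x := by
  rw [le_one_div (div_pos hx ht) hG, one_div_div]

/-- If `g` has slope at least `2` and is piecewise affine with slopes `2` and `4`, then its
generalized inverse, evaluated at `t / x`, is a fan of rarefaction waves and constant states. -/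
lemma isRarefactionFan_of_inverse {ul ur : ℝ} {g : ℝ → ℝ} {u : ℝ → ℝ → ℝ}
    (hg : ∀ v w, ur ≤ v → v ≤ w → w ≤ ul → g v + 2 * (w - v) ≤ g w)
    (hu₀ : ∀ x t, 0 < t → x ≤ 0 → u x t = ul)
    (hu : ∀ x t, 0 < t → 0 < x → ∀ y ∈ Icc ur ul,
      (∀ w ∈ Icc ur ul, w < y → g w ≤ t / x) → (∀ w ∈ Icc ur ul, y < w → t / x < g w) →
        u x t = y)
    {n : ℕ} {v m c : ℕ → ℝ} (hv0 : v 0 = ur) (hvn : v (n + 1) = ul)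
    (hlt : ∀ i ≤ n, v i < v (i + 1))
    (hmc : ∀ i ≤ n, (c i = 1 ∨ (c i = 2 ∧ m i = 0)) ∧ m i ≤ v i)
    (hgv : ∀ i ≤ n, ∀ y ∈ Ioo (v i) (v (i + 1)), g y = affineG 1 (c i) (m i) y) :
    IsRarefactionFan 1 ul ur g u := by
  have hlow : ∀ i ≤ n + 1, ur ≤ v i := by
    intro i
    induction i with
    | zero => intro _; exact hv0.ge
    | succ j ih => intro hj; exact (ih (by omega)).trans (hlt j (by omega)).le
  have hhigh : ∀ j ≤ n + 1, v (n + 1 - j) ≤ ul := by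
    intro j
    induction j with
    | zero => intro _; exact hvn.le
    | succ j ih =>
      intro hj
      have h1 := hlt (n + 1 - (j + 1)) (by omega)
      rw [show n + 1 - (j + 1) + 1 = n + 1 - j by omega] at h1
      exact h1.le.trans (ih (by omega))
  have hup : ∀ i ≤ n + 1, v i ≤ ul := fun i hi => by
    have := hhigh (n + 1 - i) (by omega)
    rwa [show n + 1 - (n + 1 - i) = i by omega] at this
  have hc1 : ∀ i ≤ n, 1 ≤ c i ∧ c i ≤ 2 := fun i hi => by
    rcases (hmc i hi).1 with h | ⟨h, -⟩ <;> rw [h] <;> norm_num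
  have haff : ∀ i y, affineG 1 (c i) (m i) y = 1 + 2 * c i * (y - m i) := fun i y => by
    unfold affineG; ring
  have hpos : ∀ i ≤ n, ∀ y, v i ≤ y → 1 ≤ affineG 1 (c i) (m i) y := fun i hi y hy => by
    rw [haff]
    have := mul_nonneg (zero_le_one.trans (hc1 i hi).1) (sub_nonneg.2 ((hmc i hi).2.trans hy))
    linarith
  -- Both comparisons pass to an intermediate point `y'` in the open piece, close enough to `y`
  -- for the slope of the affine function, at most `4`, to be outweighed by the slope of `g`.
  have hbelow : ∀ i ≤ n, ∀ y ∈ Icc (v i) (v (i + 1)), ∀ w ∈ Icc ur ul, w < y →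
      g w ≤ affineG 1 (c i) (m i) y := by
    intro i hi y hy w hw hwy
    obtain ⟨y', h1, h2⟩ : ∃ y', max w (v i) < y' ∧ y' < min (v (i + 1)) (2 * y - w) := by
      refine exists_between (max_lt (lt_min (hwy.trans_le hy.2) (by linarith))
        (lt_min (hlt i hi) ?_))
      linarith [hy.1]
    rw [max_lt_iff] at h1; rw [lt_min_iff] at h2
    have h3 := hg w y' hw.1 h1.1.le (h2.1.le.trans (hup (i + 1) (by omega)))
    rw [hgv i hi y' ⟨h1.2, h2.1⟩, haff] at h3
    rw [haff]
    have hc := hc1 i hi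
    rcases le_total y' y with h | h <;> nlinarith
  have habove : ∀ i ≤ n, ∀ y ∈ Icc (v i) (v (i + 1)), ∀ w ∈ Icc ur ul, y < w →
      affineG 1 (c i) (m i) y < g w := by
    intro i hi y hy w hw hyw
    obtain ⟨y', h1, h2⟩ : ∃ y', max (2 * y - w) (v i) < y' ∧ y' < min (v (i + 1)) w := by
      refine exists_between (max_lt (lt_min ?_ (by linarith))
        (lt_min (hlt i hi) (hy.1.trans_lt hyw)))
      linarith [hy.2]
    rw [max_lt_iff] at h1; rw [lt_min_iff] at h2
    have h3 := hg y' w ((hlow i (by omega)).trans h1.2.le) h2.2.le hw.2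
    rw [hgv i hi y' ⟨h1.2, h2.1⟩, haff] at h3
    rw [haff]
    have hc := hc1 i hi
    rcases le_total y' y with h | h <;> nlinarith
  have hmem : ∀ i ≤ n, ∀ y ∈ Icc (v i) (v (i + 1)), y ∈ Icc ur ul := fun i hi y hy =>
    ⟨(hlow i (by omega)).trans hy.1, hy.2.trans (hup (i + 1) (by omega))⟩
  have hl : ∀ i ≤ n, v i ∈ Icc (v i) (v (i + 1)) := fun i hi => ⟨le_rfl, (hlt i hi).le⟩
  have hr : ∀ i ≤ n, v (i + 1) ∈ Icc (v i) (v (i + 1)) := fun i hi => ⟨(hlt i hi).le, le_rfl⟩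
  have hxpos : ∀ {x t G : ℝ}, 0 < t → 1 ≤ G → 1 / G ≤ x / t → 0 < x := by
    intro x t G ht hG h
    have : 0 < x / t := (one_div_pos.2 (one_pos.trans_le hG)).trans_le h
    by_contra hcon
    exact this.not_ge (div_nonpos_of_nonpos_of_nonneg (not_lt.1 hcon) ht.le)
  refine ⟨n, v, m, c, hv0, hvn, fun i hi => by simpa using hlt i hi,
    fun i hi => ⟨(hmc i hi).1, by simpa using (hmc i hi).2⟩,
    fun i hi y h1 h2 => hgv i hi y ⟨by simpa using h1, by simpa using h2⟩, ?_, ?_⟩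
  · intro i hi
    refine le_of_forall_gt_imp_ge_of_dense fun G hG => ?_
    set q := v (i + 1) with hq
    have hqlt : q < v (i + 1 + 1) := hlt (i + 1) (by omega)
    obtain ⟨y', h1, h2⟩ : ∃ y', q < y' ∧
        y' < min (v (i + 1 + 1)) (q + (G - affineG 1 (c (i + 1)) (m (i + 1)) q) / 4) :=
      exists_between (lt_min hqlt (by linarith))
    rw [lt_min_iff] at h2
    have h3 := habove i (by omega) q (hr i (by omega)) y'
      (hmem (i + 1) (by omega) y' ⟨h1.le, h2.1.le⟩) h1
    rw [hgv (i + 1) (by omega) y' ⟨h1, h2.1⟩, haff (i + 1)] at h3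
    have h4 := h2.2
    rw [haff (i + 1)] at h4
    have hc := hc1 (i + 1) (by omega)
    nlinarith
  · intro x t ht
    refine ⟨fun h => ?_, fun i hi h1 h2 => ?_, fun i hi h1 h2 => ?_, fun h => ?_⟩
    · rcases le_or_gt x 0 with hx | hx
      · exact hu₀ x t ht hx
      have hG := hpos n le_rfl _ (hr n le_rfl).1
      rw [div_le_one_div_iff' hx ht (one_pos.trans_le hG)] at h
      have hmem' := hmem n le_rfl _ (hr n le_rfl)
      rw [← hvn]
      refine hu x t ht hx _ hmem' (fun w hw hlt' => ?_) (fun w hw hlt' => ?_)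
      · exact (hbelow n le_rfl _ (hr n le_rfl) w hw hlt').trans h
      · exact absurd hw.2 (not_le.2 (hvn ▸ hlt'))
    · have hx := hxpos ht (hpos i hi _ (hr i hi).1) h1
      rw [one_div_le_div_iff' hx ht (one_pos.trans_le (hpos i hi _ (hr i hi).1)), haff] at h1
      rw [div_le_one_div_iff' hx ht (one_pos.trans_le (hpos i hi _ le_rfl)), haff] at h2
      have hc := hc1 i hi
      have hc0 : 0 < 2 * c i := by linarith
      set y := m i + 1 / (2 * c i) * (t / x - 1) with hy
      have hy' : 2 * c i * (y - m i) = t / x - 1 := by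
        rw [hy, add_sub_cancel_left, ← mul_assoc, mul_one_div_cancel hc0.ne', one_mul]
      have hyI : y ∈ Icc (v i) (v (i + 1)) := by
        constructor
        · have : 2 * c i * (v i - m i) ≤ 2 * c i * (y - m i) := by linarith
          linarith [le_of_mul_le_mul_left this hc0]
        · have : 2 * c i * (y - m i) ≤ 2 * c i * (v (i + 1) - m i) := by linarith
          linarith [le_of_mul_le_mul_left this hc0]
      have hya : affineG 1 (c i) (m i) y = t / x := by rw [haff]; linarith
      refine hu x t ht hx y (hmem i hi y hyI) (fun w hw h => ?_) (fun w hw h => ?_)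
      · exact hya ▸ hbelow i hi y hyI w hw h
      · exact hya ▸ habove i hi y hyI w hw h
    · have hx := hxpos ht (hpos (i + 1) (by omega) _ le_rfl) h1
      rw [one_div_le_div_iff' hx ht (one_pos.trans_le (hpos (i + 1) (by omega) _ le_rfl))] at h1
      rw [div_le_one_div_iff' hx ht
        (one_pos.trans_le (hpos i (by omega) _ (hr i (by omega)).1))] at h2
      refine hu x t ht hx _ (hmem i (by omega) _ (hr i (by omega))) (fun w hw h => ?_)
        (fun w hw h => ?_)
      · exact (hbelow i (by omega) _ (hr i (by omega)) w hw h).trans h2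
      · exact h1.trans_lt (habove (i + 1) (by omega) _ (hl (i + 1) (by omega)) w hw h)
    · have hx := hxpos ht (hpos 0 (by omega) _ le_rfl) h
      rw [one_div_le_div_iff' hx ht (one_pos.trans_le (hpos 0 (by omega) _ le_rfl))] at h
      rw [← hv0]
      refine hu x t ht hx _ (hmem 0 (by omega) _ (hl 0 (by omega))) (fun w hw hlt' => ?_)
        (fun w hw hlt' => ?_)
      · exact absurd hw.1 (not_le.2 (hv0 ▸ hlt'))
      · exact h.trans_lt (habove 0 (by omega) _ (hl 0 (by omega)) w hw hlt')

/-! ### The generalized inverse -/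

section Up

variable {a ul ur : ℝ} {z : ℝ × ℝ → ℝ} {x t : ℝ}

lemma riemannU_of_le (h : ur ≤ ul) (x t : ℝ) : riemannU a ul ur z x t =
    sSup (insert ur {v | v ∈ Icc ur ul ∧ x * gUp a z v ≤ t}) := if_pos h

lemma mem_upperBounds_riemannU (h : ur ≤ ul) (x t : ℝ) :
    ul ∈ upperBounds (insert ur {v | v ∈ Icc ur ul ∧ x * gUp a z v ≤ t}) := by
  rintro v (rfl | hv)
  · exact h
  · exact hv.1.2

lemma riemannU_mem_Icc (h : ur ≤ ul) (x t : ℝ) : riemannU a ul ur z x t ∈ Icc ur ul := by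
  rw [riemannU_of_le h]
  exact ⟨le_csSup ⟨ul, mem_upperBounds_riemannU h x t⟩ (mem_insert _ _),
    csSup_le (insert_nonempty _ _) (mem_upperBounds_riemannU h x t)⟩

lemma le_riemannU (h : ur ≤ ul) {v : ℝ} (hv : v ∈ Icc ur ul) (hx : x * gUp a z v ≤ t) :
    v ≤ riemannU a ul ur z x t := by
  rw [riemannU_of_le h]
  exact le_csSup ⟨ul, mem_upperBounds_riemannU h x t⟩ (mem_insert_of_mem _ ⟨hv, hx⟩)

lemma riemannU_mono (h : ur ≤ ul) (x : ℝ) : Monotone (riemannU a ul ur z x) := by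
  intro s t hst
  rw [riemannU_of_le h, riemannU_of_le h]
  refine csSup_le_csSup ⟨ul, mem_upperBounds_riemannU h x t⟩ (insert_nonempty _ _) ?_
  exact insert_subset_insert fun v hv => ⟨hv.1, hv.2.trans hst⟩

lemma riemannU_of_nonpos (h : ur ≤ ul) (hx : x ≤ 0) (ht : 0 ≤ t) :
    riemannU a ul ur z x t = ul := by
  refine le_antisymm (riemannU_mem_Icc h x t).2 (le_riemannU h (right_mem_Icc.2 h) ?_)
  exact (mul_nonpos_of_nonpos_of_nonneg hx (zero_le_one.trans (one_le_gUp _))).trans ht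

lemma riemannU_zero (h : ur ≤ ul) (hx : 0 < x) : riemannU a ul ur z x 0 = ur := by
  rw [riemannU_of_le h]
  have : {v | v ∈ Icc ur ul ∧ x * gUp a z v ≤ 0} = ∅ := by
    refine eq_empty_of_forall_notMem fun v hv => hv.2.not_gt ?_
    exact mul_pos hx (one_pos.trans_le (one_le_gUp v))
  rw [this]; simp

variable (hg : ∀ v w, ur ≤ v → v ≤ w → w ≤ ul → gUp a z v + 2 * (w - v) ≤ gUp a z w)
include hg

lemma mul_gUp_le_of_lt_riemannU (h : ur ≤ ul) (ht : 0 ≤ t) {v : ℝ} (hv : ur ≤ v)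
    (hvu : v < riemannU a ul ur z x t) : x * gUp a z v ≤ t := by
  rcases le_or_gt x 0 with hx | hx
  · exact (mul_nonpos_of_nonpos_of_nonneg hx (zero_le_one.trans (one_le_gUp _))).trans ht
  rw [riemannU_of_le h] at hvu
  obtain ⟨w, hw, hvw⟩ := exists_lt_of_lt_csSup (insert_nonempty _ _) hvu
  rcases hw with rfl | hw
  · exact absurd hv hvw.not_ge
  · have := hg v w hv hvw.le hw.1.2
    exact (mul_le_mul_of_nonneg_left (by linarith) hx.le).trans hw.2

lemma riemannU_eq_of_inverse (h : ur ≤ ul) (ht : 0 < t) (hx : 0 < x) {y : ℝ} (hy : y ∈ Icc ur ul)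
    (h1 : ∀ w ∈ Icc ur ul, w < y → gUp a z w ≤ t / x)
    (h2 : ∀ w ∈ Icc ur ul, y < w → t / x < gUp a z w) : riemannU a ul ur z x t = y := by
  refine le_antisymm ?_ ?_
  · by_contra! hcon
    obtain ⟨w, hyw, hwu⟩ := exists_between hcon
    have h3 := mul_gUp_le_of_lt_riemannU hg h ht.le (hy.1.trans hyw.le) hwu
    have h4 := h2 w ⟨hy.1.trans hyw.le, hwu.le.trans (riemannU_mem_Icc h x t).2⟩ hyw
    rw [div_lt_iff₀ hx] at h4
    linarith
  · by_contra! hcon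
    obtain ⟨w, huw, hwy⟩ := exists_between hcon
    have hw : w ∈ Icc ur ul := ⟨(riemannU_mem_Icc h x t).1.trans huw.le, hwy.le.trans hy.2⟩
    have h3 := h1 w hw hwy
    rw [le_div_iff₀ hx, mul_comm] at h3
    exact (le_riemannU h hw h3).not_gt huw

/-- As `g` has slope at least `2`, the input at `x > 0` is Lipschitz with constant `1 / (2x)`. -/
lemma riemannU_sub_le (h : ur ≤ ul) (hx : 0 < x) {s : ℝ} (hs : 0 ≤ s) (hst : s ≤ t) :
    riemannU a ul ur z x t - riemannU a ul ur z x s ≤ (2 * x)⁻¹ * (t - s) := by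
  by_contra! hcon
  have hnn : 0 ≤ (2 * x)⁻¹ * (t - s) := mul_nonneg (by positivity) (sub_nonneg.2 hst)
  obtain ⟨d, hd1, hd2⟩ := exists_between hcon
  set U := riemannU a ul ur z x t
  set U' := riemannU a ul ur z x s
  set ε := (U - U' - d) / 3 with hε
  have hU' := riemannU_mem_Icc (a := a) (z := z) h x s
  have hU := riemannU_mem_Icc (a := a) (z := z) h x t
  have h1 : x * gUp a z (U - ε) ≤ t :=
    mul_gUp_le_of_lt_riemannU hg h (hs.trans hst) (by linarith [hU'.1])
      (show U - ε < U by linarith)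
  have h2 : s < x * gUp a z (U' + ε) := by
    by_contra! h3
    have h4 := le_riemannU h ⟨by linarith [hU'.1], by linarith [hU.2]⟩ h3
    change U' + ε ≤ U' at h4
    linarith
  have h3 := hg (U' + ε) (U - ε) (by linarith [hU'.1]) (by linarith) (by linarith [hU.2])
  have h4 : x * (2 * (U - ε - (U' + ε))) ≤ x * (gUp a z (U - ε) - gUp a z (U' + ε)) :=
    mul_le_mul_of_nonneg_left (by linarith) hx.le
  rw [inv_mul_lt_iff₀ (by positivity)] at hd1
  have h5 : 2 * x * d < 2 * x * (U - ε - (U' + ε)) :=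
    mul_lt_mul_of_pos_left (by linarith) (by positivity)
  nlinarith

lemma continuousOn_riemannU (h : ur ≤ ul) (hx : x ≠ 0) :
    ContinuousOn (riemannU a ul ur z x) (Ici 0) := by
  rcases hx.lt_or_gt with hx | hx
  · refine continuousOn_const.congr (f := fun _ => ul) fun t ht => ?_
    exact riemannU_of_nonpos h hx.le ht
  · refine (LipschitzOnWith.of_le_add_mul (Real.toNNReal (2 * x)⁻¹)
      fun s hs t ht => ?_).continuousOn
    rw [Real.coe_toNNReal _ (by positivity), Real.dist_eq]
    rcases le_total t s with hts | hts
    · have := riemannU_sub_le hg h hx ht hts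
      rw [abs_of_nonneg (sub_nonneg.2 hts)]; linarith
    · have := riemannU_mono (a := a) (z := z) h x hts
      have h2 : 0 ≤ (2 * x)⁻¹ * |s - t| := by positivity
      linarith

/-- Integrals over the fronts that have passed `x` before the time `t`. -/
lemma integral_mul_front (h : ur ≤ ul) (ht : 0 ≤ t) (F : ℝ → ℝ) :
    ∫ v in Icc ur ul, F v * front (gUp a z v) x t =
      ∫ v in Icc ur (riemannU a ul ur z x t), F v := by
  set U := riemannU a ul ur z x t with hUdef
  have hU := riemannU_mem_Icc (a := a) (z := z) h x t
  have hsub : Icc ur U ⊆ Icc ur ul := Icc_subset_Icc_right hU.2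
  rw [← inter_eq_self_of_subset_right hsub, ← setIntegral_indicator measurableSet_Icc]
  refine setIntegral_congr_ae measurableSet_Icc ?_
  have hne : ∀ᵐ v : ℝ, v ≠ U := by simp [ae_iff]
  filter_upwards [hne] with v hv hvI
  rcases hv.lt_or_gt with hlt | hlt
  · rw [indicator_of_mem (show v ∈ Icc ur U from ⟨hvI.1, hlt.le⟩), front,
      if_pos (mul_gUp_le_of_lt_riemannU hg h ht hvI.1 hlt), mul_one]
  · rw [indicator_of_notMem (fun h' => hlt.not_ge h'.2), front,
      if_neg (fun h' => hlt.not_ge (le_riemannU h hvI h')), mul_zero]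

lemma riemannU_eq_integral (h : ur ≤ ul) (ht : 0 ≤ t) :
    riemannU a ul ur z x t = ur + ∫ v in Icc ur ul, 1 * front (gUp a z v) x t := by
  have hU := riemannU_mem_Icc (a := a) (z := z) h x t
  rw [integral_mul_front hg h ht (fun _ => 1)]
  simp [hU.1]

end Up

/-- The wave structure for an input that increases from `u_r` to `u_l`. -/
lemma isRarefactionFan_riemannU {a ul ur : ℝ} {z : ℝ × ℝ → ℝ} (hul : ul ≤ a)
    (hur : -a ≤ ur) (h : ur < ul) (hz : IsConfig z) (hc : Compatible a ur z)
    (hf : HasFiniteGraph a z) :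
    IsRarefactionFan 1 ul ur (gUp a z) (riemannU a ul ur z) := by
  have hg : ∀ v w, ur ≤ v → v ≤ w → w ≤ ul → gUp a z v + 2 * (w - v) ≤ gUp a z w :=
    fun v w h1 h2 h3 => hz.gUp_add_le hc hur h1 h2 (h3.trans hul)
  obtain ⟨H, V, hHV⟩ := hf
  obtain ⟨n, v, hv0, hvn, hlt, hpiece⟩ := exists_subdivision_of_antitone (b := lowerEdge a z) h
    (fun v hv w hw hvw => hz.lowerEdge_antitone hc hur hv.1.le hvw (hw.2.le.trans hul))
    (H := H) (V := insert (-a) V) (fun v hv => by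
      have hva : v ≤ a := hv.2.le.trans hul
      have hle := hz.lowerEdge_le_input hc hur hva
      rcases (neg_le_lowerEdge (z := z) (hur.trans hv.1.le)).eq_or_lt with h1 | h1
      · exact Or.inr (Or.inr (h1 ▸ Finset.mem_insert_self _ _))
      · rcases hHV _ (hz.lowerEdge_mem_graph hva h1 (hle.trans_lt hv.1)) with h2 | h2 | h2
        · left; simp only at h2; linarith
        · exact Or.inr (Or.inl h2)
        · exact Or.inr (Or.inr (Finset.mem_insert_of_mem h2)))
  have hmc : ∀ i, ∃ m c : ℝ, i ≤ n → ((c = 1 ∨ (c = 2 ∧ m = 0)) ∧ m ≤ v i) ∧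
      ∀ y ∈ Ioo (v i) (v (i + 1)), gUp a z y = affineG 1 c m y := by
    intro i
    by_cases hi : i ≤ n
    swap
    · exact ⟨0, 0, fun h => absurd h hi⟩
    obtain ⟨hsub, ⟨p, hp⟩ | hp⟩ := hpiece i hi
    · refine ⟨p, 1, fun _ => ⟨⟨Or.inl rfl, ?_⟩, fun y hy => ?_⟩⟩
      · refine le_of_forall_gt_imp_ge_of_dense fun r hr => ?_
        obtain ⟨y, h1, h2⟩ := exists_between (lt_min hr (hlt i hi))
        rw [lt_min_iff] at h2
        exact (hp y ⟨h1, h2.2⟩ ▸ lowerEdge_le_self y).trans h2.1.le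
      · rw [gUp_eq, hp y hy]; unfold affineG; ring
    · refine ⟨0, 2, fun _ => ⟨⟨Or.inr ⟨rfl, rfl⟩, ?_⟩, fun y hy => ?_⟩⟩
      · refine le_of_forall_gt_imp_ge_of_dense fun r hr => ?_
        obtain ⟨y, h1, h2⟩ := exists_between (lt_min hr (hlt i hi))
        rw [lt_min_iff] at h2
        have h3 := lowerEdge_le_self (a := a) (z := z) y
        rw [hp y ⟨h1, h2.2⟩] at h3
        linarith
      · rw [gUp_eq, hp y hy]; unfold affineG; ring
  choose m c hmc using hmc
  exact isRarefactionFan_of_inverse hg (fun x t ht hx => riemannU_of_nonpos h.le hx ht.le)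
    (fun x t ht hx y hy h1 h2 => riemannU_eq_of_inverse hg h.le ht hx hy h1 h2) hv0 hvn hlt
    (fun i hi => (hmc i hi).1) (fun i hi => (hmc i hi).2)

/-! ### Relays driven by a monotone input -/

lemma relay_of_monotone {ρ : ℝ × ℝ} {u : ℝ → ℝ} {z₀ t : ℝ} (hρ : ρ ∈ plane) (hu : Monotone u)
    (ht : 0 ≤ t) : relay ρ u z₀ t = if ρ.2 ≤ u t then 1 else if u 0 ≤ ρ.1 then -1 else z₀ := by
  have h1 : (∃ s ∈ Icc 0 t, ρ.2 ≤ u s ∧ ∀ r ∈ Icc s t, ρ.1 < u r) ↔ ρ.2 ≤ u t := by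
    constructor
    · rintro ⟨s, hs, h, -⟩; exact h.trans (hu hs.2)
    · intro h
      refine ⟨t, ⟨ht, le_rfl⟩, h, fun r hr => ?_⟩
      rw [le_antisymm hr.2 hr.1]; exact lt_of_lt_of_le hρ h
  unfold relay
  by_cases h2 : ρ.2 ≤ u t
  · rw [if_pos (h1.2 h2), if_pos h2]
  · rw [if_neg (fun h => h2 (h1.1 h)), if_neg h2]
    by_cases h3 : u 0 ≤ ρ.1
    · rw [if_pos h3,
        if_pos ⟨0, ⟨le_rfl, ht⟩, h3, fun r hr => (hu hr.2).trans_lt (not_le.1 h2)⟩]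
    · rw [if_neg h3, if_neg]
      rintro ⟨s, hs, h, -⟩
      exact h3 ((hu hs.1).trans h)

lemma region_iff {k w : ℝ} {ρ : ℝ × ℝ} (hw : w = 1 ∨ w = -1) :
    (k, w) ∈ region ρ ↔ (k ≤ ρ.1 → w = -1) ∧ (ρ.2 ≤ k → w = 1) := by
  have hne : (1 : ℝ) ≠ -1 := by norm_num
  rcases hw with rfl | rfl
  · simp only [region, mem_union, mem_ofPred_eq, and_true, hne, and_false, or_false, imp_false,
      not_le, implies_true]
  · simp only [region, mem_union, mem_ofPred_eq, and_true, hne.symm, and_false, false_or,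
      imp_false, not_le, implies_true, true_and]

section Up

variable {a ul ur : ℝ} {zl zr : ℝ × ℝ → ℝ} {x t : ℝ}

lemma riemannZ_eq (h : ur ≤ ul) (ht : 0 ≤ t) {ρ : ℝ × ℝ} (hρ : ρ ∈ plane) :
    riemannZ a ul ur zl zr x t ρ = if ρ.2 ≤ riemannU a ul ur zr x t then 1 else
      if riemannU a ul ur zr x 0 ≤ ρ.1 then -1 else riemannDatum zl zr x ρ :=
  relay_of_monotone hρ (riemannU_mono h x) ht

lemma ae_compatible {a k : ℝ} {z : ℝ × ℝ → ℝ} (hz : IsConfig z) (hc : Compatible a k z) :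
    ∀ᵐ ρ ∂(volume.restrict (triangle a)), (k ≤ ρ.1 → z ρ = -1) ∧ (ρ.2 ≤ k → z ρ = 1) := by
  filter_upwards [hc, ae_restrict_mem (measurableSet_triangle a)] with ρ h hρ
  exact (region_iff (hz.values ρ (triangle_subset_plane a hρ))).1 h

lemma ae_riemannZ_of_neg (h : ur ≤ ul) (hzl : IsConfig zl) (hcl : Compatible a ul zl)
    (hx : x < 0) (ht : 0 ≤ t) :
    ∀ᵐ ρ ∂(volume.restrict (triangle a)), riemannZ a ul ur zl zr x t ρ = zl ρ := by
  filter_upwards [ae_compatible hzl hcl, ae_restrict_mem (measurableSet_triangle a)] with ρ hρ hT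
  rw [riemannZ_eq h ht (triangle_subset_plane a hT), riemannU_of_nonpos h hx.le ht,
    riemannU_of_nonpos h hx.le le_rfl]
  split_ifs with h1 h2
  · exact (hρ.2 h1).symm
  · exact (hρ.1 h2).symm
  · simp [riemannDatum, hx]

lemma ae_riemannZ_of_pos (h : ur ≤ ul) (hzr : IsConfig zr) (hcr : Compatible a ur zr)
    (hx : 0 < x) (ht : 0 ≤ t) :
    ∀ᵐ ρ ∂(volume.restrict (triangle a)), riemannZ a ul ur zl zr x t ρ =
      if ρ.2 ≤ riemannU a ul ur zr x t then 1 else zr ρ := by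
  filter_upwards [ae_compatible hzr hcr, ae_restrict_mem (measurableSet_triangle a)] with ρ hρ hT
  rw [riemannZ_eq h ht (triangle_subset_plane a hT), riemannU_zero h hx]
  split_ifs with h1 h2
  · rfl
  · exact (hρ.1 h2).symm
  · simp [riemannDatum, hx.not_gt]

lemma hasWaveStates_of_le (h : ur ≤ ul) (hzl : IsConfig zl) (hzr : IsConfig zr)
    (hcl : Compatible a ul zl) (hcr : Compatible a ur zr) :
    HasWaveStates a ul ur zl zr (riemannU a ul ur zr) (riemannZ a ul ur zl zr) := by
  refine fun x t ht => ⟨fun hx => ae_riemannZ_of_neg h hzl hcl hx ht,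
    fun hx _ => ae_riemannZ_of_pos h hzr hcr hx ht, fun hx h' => ?_⟩
  obtain rfl := le_antisymm h h'
  have hu : riemannU a ur ur zr x t = ur :=
    le_antisymm (riemannU_mem_Icc le_rfl x t).2 (riemannU_mem_Icc le_rfl x t).1
  filter_upwards [ae_riemannZ_of_pos (zl := zl) le_rfl hzr hcr hx ht, ae_compatible hzr hcr,
    ae_restrict_mem (measurableSet_triangle a)] with ρ h1 h2 hT
  rw [h1, hu]
  split_ifs with h3 h4 h4
  · exact absurd (h3.trans h4) (not_le.2 hT.2.1)
  · exact (h2.2 h3).symm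
  · exact h2.1 h4
  · rfl

lemma integrableOn_riemannZ_of_le (h : ur ≤ ul) (hzl : IsConfig zl) (hzr : IsConfig zr)
    (ht : 0 ≤ t) : IntegrableOn (riemannZ a ul ur zl zr x t) (triangle a) := by
  have hz₀ : IsConfig (riemannDatum zl zr x) := by
    unfold riemannDatum; split_ifs; exacts [hzl, hzr]
  have hm : AEStronglyMeasurable (fun ρ : ℝ × ℝ => if ρ.2 ≤ riemannU a ul ur zr x t then 1 else
      if riemannU a ul ur zr x 0 ≤ ρ.1 then -1 else plane.indicator (riemannDatum zl zr x) ρ)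
      (volume.restrict (triangle a)) :=
    (Measurable.ite (measurableSet_le measurable_snd measurable_const) measurable_const
      (Measurable.ite (measurableSet_le measurable_const measurable_fst) measurable_const
        hz₀.measurable_indicator)).aestronglyMeasurable
  refine Integrable.of_bound (hm.congr ?_) 1 ?_
  · filter_upwards [ae_restrict_mem (measurableSet_triangle a)] with ρ hT
    rw [riemannZ_eq h ht (triangle_subset_plane a hT),
      indicator_of_mem (triangle_subset_plane a hT)]
  · filter_upwards [ae_restrict_mem (measurableSet_triangle a)] with ρ hT
    rw [riemannZ_eq h ht (triangle_subset_plane a hT), Real.norm_eq_abs]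
    split_ifs
    · simp
    · simp
    · exact (hz₀.abs_eq (triangle_subset_plane a hT)).le

end Up

/-! ### Integrals over the relays that have switched -/

/-- Integral of `D` over the horizontal section of the triangle at height `v`. -/
noncomputable def sliceIntegral (a : ℝ) (D : ℝ × ℝ → ℝ) (v : ℝ) : ℝ :=
  ∫ r, (triangle a).indicator D (r, v)

section Slices

variable {a : ℝ} {z D : ℝ × ℝ → ℝ}

lemma measurable_sliceIntegral (hD : Measurable ((triangle a).indicator D)) :
    Measurable (sliceIntegral a D) :=
  (hD.stronglyMeasurable.integral_prod_left' (μ := volume)).measurable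

lemma IsConfig.indicator_one_sub (hz : IsConfig z) (v : ℝ) :
    (fun r => (triangle a).indicator (fun ρ => 1 - z ρ) (r, v)) =
      {r : ℝ | (r, v) ∈ triangle a ∧ z (r, v) = -1}.indicator fun _ => 2 := by
  ext r
  by_cases h : (r, v) ∈ triangle a
  · rw [indicator_of_mem h]
    rcases hz.values _ (triangle_subset_plane a h) with h1 | h1
    · rw [indicator_of_notMem, h1, sub_self]
      intro h2; have := h1.symm.trans h2.2; norm_num at this
    · rw [indicator_of_mem (show r ∈ {r : ℝ | (r, v) ∈ triangle a ∧ z (r, v) = -1} from ⟨h, h1⟩),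
        h1]; norm_num
  · rw [indicator_of_notMem h, indicator_of_notMem (fun h2 => h h2.1)]

lemma IsConfig.integrable_slice_one_sub (hz : IsConfig z) (v : ℝ) :
    Integrable fun r => (triangle a).indicator (fun ρ => 1 - z ρ) (r, v) := by
  rw [hz.indicator_one_sub]
  exact (integrableOn_const (neg_slice_ne_top v)).integrable_indicator
    (measurable_prodMk_right hz.measurableSet_neg)

/-- Each relay of the section that switches from `-1` to `+1` contributes the height `2`. -/
lemma IsConfig.sliceIntegral_one_sub (hz : IsConfig z) (v : ℝ) :
    sliceIntegral a (fun ρ => 1 - z ρ) v = gUp a z v - 1 := by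
  have hm : MeasurableSet {r : ℝ | (r, v) ∈ triangle a ∧ z (r, v) = -1} :=
    measurable_prodMk_right hz.measurableSet_neg
  unfold sliceIntegral
  rw [hz.indicator_one_sub, integral_indicator hm, setIntegral_const, Measure.real, gUp,
    horizLength, smul_eq_mul]
  ring

lemma IsConfig.abs_sliceIntegral_le (hz : IsConfig z)
    (hb : ∀ ρ ∈ triangle a, |D ρ| ≤ 1 - z ρ) (v : ℝ) :
    |sliceIntegral a D v| ≤ gUp a z v - 1 := by
  rw [← hz.sliceIntegral_one_sub, ← Real.norm_eq_abs]
  refine norm_integral_le_of_norm_le (f := fun r => (triangle a).indicator D (r, v))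
    (hz.integrable_slice_one_sub (a := a) v)
    (Filter.Eventually.of_forall fun r => ?_)
  by_cases h : (r, v) ∈ triangle a
  · rw [indicator_of_mem h, indicator_of_mem h]; exact hb _ h
  · rw [indicator_of_notMem h, indicator_of_notMem h, norm_zero]

/-- Fubini's theorem for the relays with upper threshold at most `U`, of which only those above
`k` contribute. -/
lemma setIntegral_triangle_eq {k U : ℝ} (hi : IntegrableOn D (triangle a))
    (h0 : ∀ᵐ ρ ∂(volume.restrict (triangle a)), ρ.2 ≤ k → D ρ = 0) :
    ∫ ρ in triangle a, (if ρ.2 ≤ U then D ρ else 0) =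
      ∫ v in Icc k U, sliceIntegral a D v := by
  have hS : MeasurableSet {ρ : ℝ × ℝ | ρ.2 ∈ Icc k U} := measurable_snd measurableSet_Icc
  have h1 : ∫ ρ in triangle a, (if ρ.2 ≤ U then D ρ else 0) =
      ∫ ρ in triangle a, {ρ : ℝ × ℝ | ρ.2 ∈ Icc k U}.indicator D ρ := by
    refine integral_congr_ae ?_
    filter_upwards [h0] with ρ hρ
    by_cases h : k ≤ ρ.2
    · by_cases h' : ρ.2 ≤ U
      · rw [if_pos h', indicator_of_mem (show ρ ∈ {ρ : ℝ × ℝ | ρ.2 ∈ Icc k U} from ⟨h, h'⟩)]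
      · rw [if_neg h', indicator_of_notMem (fun h'' => h' h''.2)]
    · rw [hρ (not_le.1 h).le, ite_self, indicator_of_notMem (fun h'' => h h''.1)]
  have hint : Integrable ((triangle a).indicator ({ρ : ℝ × ℝ | ρ.2 ∈ Icc k U}.indicator D))
      (volume.prod volume) := by
    rw [← Measure.volume_eq_prod]
    exact (hi.indicator hS).integrable_indicator (measurableSet_triangle a)
  rw [h1, ← integral_indicator (measurableSet_triangle a), Measure.volume_eq_prod,
    integral_prod_symm _ hint, ← integral_indicator measurableSet_Icc]
  refine integral_congr_ae (Filter.Eventually.of_forall fun v => ?_)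
  simp only
  by_cases hv : v ∈ Icc k U
  · rw [indicator_of_mem hv]
    refine integral_congr_ae (Filter.Eventually.of_forall fun r => ?_)
    simp only [indicator, mem_ofPred_eq, hv, if_true]
  · rw [indicator_of_notMem hv]
    simp only [indicator, mem_ofPred_eq, hv, if_false, ite_self, integral_zero]

lemma ae_slice {p : ℝ × ℝ → Prop} (h : ∀ᵐ ρ ∂(volume.restrict (triangle a)), p ρ) :
    ∀ᵐ v : ℝ, ∀ᵐ r : ℝ, (r, v) ∈ triangle a → p (r, v) := by
  have h1 := (ae_restrict_iff' (measurableSet_triangle a)).1 h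
  rw [Measure.volume_eq_prod] at h1
  have h2 := (Measure.measurePreserving_swap (μ := (volume : Measure ℝ))
    (ν := (volume : Measure ℝ))).quasiMeasurePreserving.ae h1
  exact Measure.ae_ae_of_ae_prod h2

end Slices

/-! ### Increasing inputs: conservation law and entropy inequality -/

section Balance

variable {φ : ℝ × ℝ → ℝ}

lemma ae_fst_ne_zero : ∀ᵐ p : ℝ × ℝ, p.1 ≠ 0 := by
  have h : ∀ᵐ x : ℝ, x ≠ 0 := by simp [ae_iff]
  rw [Measure.volume_eq_prod]
  exact Measure.quasiMeasurePreserving_fst.ae h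

lemma dt_eq_zero_of_notMem_tsupport (hφ : ContDiff ℝ 1 φ) {p : ℝ × ℝ} (hp : p ∉ tsupport φ) :
    dt φ p.1 p.2 = 0 := by
  have h : fderiv ℝ φ p = 0 := by
    by_contra hne; exact hp (support_fderiv_subset ℝ hne)
  rw [show dt φ p.1 p.2 = fderiv ℝ φ p (0, 1) from congrFun (dt_eq hφ) p, h]; rfl

lemma dx_eq_zero_of_notMem_tsupport (hφ : ContDiff ℝ 1 φ) {p : ℝ × ℝ} (hp : p ∉ tsupport φ) :
    dx φ p.1 p.2 = 0 := by
  have h : fderiv ℝ φ p = 0 := by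
    by_contra hne; exact hp (support_fderiv_subset ℝ hne)
  rw [show dx φ p.1 p.2 = fderiv ℝ φ p (1, 0) from congrFun (dx_eq hφ) p, h]; rfl

lemma exists_time_bound (hc : HasCompactSupport φ) :
    ∃ T : ℝ, 0 < T ∧ ∀ p : ℝ × ℝ, T ≤ p.2 → p ∉ tsupport φ := by
  obtain ⟨R, hR⟩ := (hc.isCompact.image continuous_snd).bddAbove
  refine ⟨max R 0 + 1, by positivity, fun p hp hps => ?_⟩
  have := hR ⟨p, hps, rfl⟩
  have h2 := le_max_left R 0
  linarith

end Balance

section Up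

variable {a ul ur T C q₀ : ℝ} {zl zr : ℝ × ℝ → ℝ} {φ : ℝ × ℝ → ℝ} {A B e : ℝ → ℝ}
  {E Q : ℝ → ℝ → ℝ}

/-- The balance law for densities and fluxes which, off the axis `x = 0`, are superpositions of
the fronts with coefficient `gUp`. -/
lemma balance_of_fronts (hzr : IsConfig zr) (hφ : ContDiff ℝ 1 φ) (hc : HasCompactSupport φ)
    (hA : Measurable A) (hAb : ∀ v, |A v| ≤ C) (hB : Measurable B) (hBb : ∀ v, |B v| ≤ C)
    (he : Measurable e) (heb : ∀ x, |e x| ≤ C)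
    (hE : ∀ x t, x ≠ 0 → 0 ≤ t → E x t = e x + ∫ v in Icc ur ul, A v * front (gUp a zr v) x t)
    (hQ : ∀ x t, x ≠ 0 → 0 ≤ t → Q x t = q₀ + ∫ v in Icc ur ul, B v * front (gUp a zr v) x t) :
    IntegrableOn (fun p : ℝ × ℝ => E p.1 p.2 * dt φ p.1 p.2 + Q p.1 p.2 * dx φ p.1 p.2)
      (univ ×ˢ Ioi 0) ∧
    ∀ T, 0 < T → ∫ p in univ ×ˢ Ioc 0 T, (E p.1 p.2 * dt φ p.1 p.2 + Q p.1 p.2 * dx φ p.1 p.2) =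
      (∫ x, E x T * φ (x, T)) - (∫ x, E x 0 * φ (x, 0)) +
        ∫ v in Icc ur ul, (B v * gUp a zr v - A v) *
          (∫ x in Ioc 0 (T / gUp a zr v), φ (x, x * gUp a zr v)) := by
  have hset : ∀ {s : Set ℝ}, MeasurableSet s → s ⊆ Ioi 0 →
      ∀ᵐ p ∂(volume.restrict ((univ : Set ℝ) ×ˢ s)),
      E p.1 p.2 * dt φ p.1 p.2 + Q p.1 p.2 * dx φ p.1 p.2 =
      (e p.1 + ∫ v in Icc ur ul, A v * front (gUp a zr v) p.1 p.2) * dt φ p.1 p.2 +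
        (q₀ + ∫ v in Icc ur ul, B v * front (gUp a zr v) p.1 p.2) * dx φ p.1 p.2 := by
    intro s hs hs0
    filter_upwards [ae_restrict_mem (MeasurableSet.univ.prod hs), ae_restrict_of_ae ae_fst_ne_zero]
      with p hp hp0
    rw [hE _ _ hp0 (le_of_lt (hs0 hp.2)), hQ _ _ hp0 (le_of_lt (hs0 hp.2))]
  have hslice : ∀ t, 0 ≤ t → ∫ x, E x t * φ (x, t) =
      ∫ x, (e x + ∫ v in Icc ur ul, A v * front (gUp a zr v) x t) * φ (x, t) := by
    intro t ht
    have hne : ∀ᵐ x : ℝ, x ≠ 0 := by simp [ae_iff]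
    refine integral_congr_ae ?_
    filter_upwards [hne] with x hx
    rw [hE x t hx ht]
  constructor
  · exact (integrableOn_superposed_fronts hφ hc hA hAb hB hBb hzr.measurable_gUp he heb
      (ν := volume.restrict (Icc ur ul)) (q₀ := q₀)).congr
      ((hset measurableSet_Ioi le_rfl).mono fun p hp => hp.symm)
  · intro T hT
    rw [integral_congr_ae (hset measurableSet_Ioc fun t ht => ht.1), hslice T hT.le,
      hslice 0 le_rfl]
    exact integral_superposed_fronts hφ hc hT hA hAb hB hBb hzr.measurable_gUp
      (fun v => one_le_gUp v) he heb

lemma measurable_riemannDatum {α : Type*} [MeasurableSpace α] (l r : α) :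
    Measurable (riemannDatum l r) := by
  unfold riemannDatum
  exact Measurable.ite (measurableSet_lt measurable_id measurable_const) measurable_const
    measurable_const

lemma abs_riemannDatum_le (l r x : ℝ) : |riemannDatum l r x| ≤ |l| + |r| := by
  unfold riemannDatum
  split_ifs
  · linarith [abs_nonneg r]
  · linarith [abs_nonneg l]

lemma abs_gUp_le (ha : 0 < a) (v : ℝ) : |gUp a zr v| ≤ 1 + 4 * a := by
  rw [abs_of_nonneg (zero_le_one.trans (one_le_gUp v))]
  have := horizLength_le_two_mul (z := zr) ha v
  unfold gUp; linarith

/-- Integrals of functions of the relay states are superpositions of fronts: when the front with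
value `v` passes, the relays with upper threshold `v` in state `-1` change the value of `P` from
`P (ρ, -1)` to `P (ρ, 1)`. -/
lemma integral_riemannZ_of_le (hz : IsConfig zl) (hzr : IsConfig zr) (h : ur ≤ ul)
    (hul : ul ≤ a) (hur : -a ≤ ur)
    (hcl : Compatible a ul zl) (hcr : Compatible a ur zr) {P : ℝ × ℝ → ℝ → ℝ}
    (hP : ∀ w, IsConfig w → IntegrableOn (fun ρ => P ρ (w ρ)) (triangle a))
    (hP1 : IntegrableOn (fun ρ => P ρ 1) (triangle a)) {x t : ℝ} (hx : x ≠ 0) (ht : 0 ≤ t) :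
    ∫ ρ in triangle a, P ρ (riemannZ a ul ur zl zr x t ρ) =
      riemannDatum ((∫ ρ in triangle a, P ρ (zl ρ)) -
          ∫ v in Icc ur ul, sliceIntegral a (fun ρ => P ρ 1 - P ρ (zr ρ)) v)
        (∫ ρ in triangle a, P ρ (zr ρ)) x +
      ∫ v in Icc ur ul, sliceIntegral a (fun ρ => P ρ 1 - P ρ (zr ρ)) v *
        front (gUp a zr v) x t := by
  have hg : ∀ v w, ur ≤ v → v ≤ w → w ≤ ul → gUp a zr v + 2 * (w - v) ≤ gUp a zr w :=
    fun v w h1 h2 h3 => hzr.gUp_add_le hcr hur h1 h2 (h3.trans hul)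
  rw [integral_mul_front hg h ht]
  rcases hx.lt_or_gt with hx | hx
  · rw [riemannU_of_nonpos h hx.le ht, riemannDatum, if_pos hx, sub_add_cancel]
    refine integral_congr_ae ?_
    filter_upwards [ae_riemannZ_of_neg (zr := zr) h hz hcl hx ht] with ρ hρ
    rw [hρ]
  · have hi : IntegrableOn (fun ρ => P ρ 1 - P ρ (zr ρ)) (triangle a) := hP1.sub (hP zr hzr)
    rw [riemannDatum, if_neg hx.not_gt, ← setIntegral_triangle_eq hi,
      ← integral_add (hP zr hzr)]
    · refine integral_congr_ae ?_
      filter_upwards [ae_riemannZ_of_pos (zl := zl) h hzr hcr hx ht] with ρ hρ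
      rw [hρ]
      split_ifs <;> ring
    · have hm : MeasurableSet {ρ : ℝ × ℝ | ρ.2 ≤ riemannU a ul ur zr x t} :=
        measurableSet_le measurable_snd measurable_const
      refine (hi.indicator hm).congr
        (Filter.Eventually.of_forall fun ρ => ?_)
      simp [indicator]
    · filter_upwards [ae_compatible hzr hcr] with ρ hρ hle
      rw [hρ.2 hle, sub_self]

/-- The conservation law holds front by front, because the density `g` and the flux `1` carried by
the front with value `v` satisfy the Rankine-Hugoniot condition for the speed `1 / g`. -/
theorem isWeakSolution_of_le (ha : 0 < a) (hul : ul ≤ a) (hur : -a ≤ ur) (h : ur ≤ ul)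
    (hzl : IsConfig zl) (hzr : IsConfig zr)
    (hcl : Compatible a ul zl) (hcr : Compatible a ur zr) :
    IsWeakSolution (riemannU a ul ur zr) (riemannW a ul ur zl zr) (riemannDatum ul ur)
      (fun x => ∫ ρ in triangle a, riemannDatum zl zr x ρ) := by
  intro φ hφ hc
  have hg : ∀ v w, ur ≤ v → v ≤ w → w ≤ ul → gUp a zr v + 2 * (w - v) ≤ gUp a zr w :=
    fun v w h1 h2 h3 => hzr.gUp_add_le hcr hur h1 h2 (h3.trans hul)
  set ν : Measure ℝ := volume.restrict (Icc ur ul) with hν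
  set G := ∫ v in Icc ur ul, (gUp a zr v - 1) with hG
  set el := ur + ((∫ ρ in triangle a, zl ρ) - G) with hel
  set er := ur + ∫ ρ in triangle a, zr ρ with her
  have hE : ∀ x t, x ≠ 0 → 0 ≤ t → riemannU a ul ur zr x t + riemannW a ul ur zl zr x t =
      riemannDatum el er x + ∫ v in Icc ur ul, gUp a zr v * front (gUp a zr v) x t := by
    intro x t hx ht
    have h1 := integral_riemannZ_of_le hzl hzr h hul hur hcl hcr (P := fun _ w => w)
      (fun w hw => hw.integrableOn) (integrableOn_const (volume_triangle_lt_top a).ne) hx ht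
    simp only [hzr.sliceIntegral_one_sub] at h1
    have hF : ∀ {F : ℝ → ℝ} {C : ℝ}, Measurable F → (∀ v, |F v| ≤ C) →
        IntegrableOn (fun v => F v * front (gUp a zr v) x t) (Icc ur ul) := by
      intro F C hFm hFb
      refine Integrable.of_bound (C := C) ((hFm.mul (measurable_front hzr.measurable_gUp
        measurable_const measurable_const)).aestronglyMeasurable)
        (Filter.Eventually.of_forall fun v => abs_mul_front_le hFb v _ _ _)
    have h2 := integral_add (hF (measurable_const (a := (1 : ℝ))) (C := 1) (by simp))
      (hF (hzr.measurable_gUp.sub_const 1) (C := 2 + 4 * a) fun v => by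
        have h3 := abs_gUp_le (zr := zr) ha v
        have h4 := abs_sub (gUp a zr v) 1
        rw [abs_one] at h4; linarith)
    unfold riemannW
    rw [h1, riemannU_eq_integral hg h ht]
    have h3 : ∫ v in Icc ur ul, gUp a zr v * front (gUp a zr v) x t =
        (∫ v in Icc ur ul, 1 * front (gUp a zr v) x t) +
          ∫ v in Icc ur ul, (gUp a zr v - 1) * front (gUp a zr v) x t := by
      rw [← h2]; congr 1; ext v; ring
    rw [h3]
    unfold riemannDatum
    split_ifs <;> ring
  have hQ : ∀ x t, x ≠ 0 → 0 ≤ t → riemannU a ul ur zr x t =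
      ur + ∫ v in Icc ur ul, 1 * front (gUp a zr v) x t :=
    fun x t _ ht => riemannU_eq_integral hg h ht
  have hbound := abs_riemannDatum_le el er
  obtain ⟨hint, hbal⟩ := balance_of_fronts (C := (|el| + |er|) + (1 + 4 * a)) hzr hφ hc
    hzr.measurable_gUp
    (fun v => (abs_gUp_le ha v).trans (le_add_of_nonneg_left (by positivity)))
    (measurable_const (a := (1 : ℝ)))
    (fun v => by rw [abs_one]; nlinarith [abs_nonneg el, abs_nonneg er])
    (measurable_riemannDatum el er)
    (fun x => (hbound x).trans (le_add_of_nonneg_right (by positivity))) hE hQ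
  -- Before any switching, the superposition of fronts is the initial datum.
  have hinit : ∀ x, x ≠ 0 → riemannU a ul ur zr x 0 + riemannW a ul ur zl zr x 0 =
      riemannDatum ul ur x + ∫ ρ in triangle a, riemannDatum zl zr x ρ := by
    intro x hx
    unfold riemannW riemannDatum
    rcases hx.lt_or_gt with hx | hx
    · rw [riemannU_of_nonpos h hx.le le_rfl, if_pos hx, if_pos hx]
      congr 1
      exact integral_congr_ae (ae_riemannZ_of_neg h hzl hcl hx le_rfl)
    · rw [riemannU_zero h hx, if_neg hx.not_gt, if_neg hx.not_gt]
      congr 1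
      refine integral_congr_ae ?_
      filter_upwards [ae_riemannZ_of_pos (zl := zl) h hzr hcr hx le_rfl, ae_compatible hzr hcr]
        with ρ h1 h2
      rw [h1, riemannU_zero h hx]
      split_ifs with h3
      · exact (h2.2 h3).symm
      · rfl
  have hne : ∀ᵐ x : ℝ, x ≠ 0 := by simp [ae_iff]
  have hinit' : ∫ x, (riemannU a ul ur zr x 0 + riemannW a ul ur zl zr x 0) * φ (x, 0) =
      ∫ x, (riemannDatum ul ur x + ∫ ρ in triangle a, riemannDatum zl zr x ρ) * φ (x, 0) := by
    refine integral_congr_ae ?_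
    filter_upwards [hne] with x hx
    rw [hinit x hx]
  refine ⟨hint, ?_, ?_⟩
  · have hd : (fun x => (riemannDatum ul ur x + ∫ ρ in triangle a, riemannDatum zl zr x ρ) *
        φ (x, 0)) = fun x => riemannDatum (ul + ∫ ρ in triangle a, zl ρ)
          (ur + ∫ ρ in triangle a, zr ρ) x * φ (x, 0) := by
      ext x; unfold riemannDatum; split_ifs <;> rfl
    rw [hd]
    exact (integrable_slice hφ hc 0).bdd_mul (measurable_riemannDatum _ _).aestronglyMeasurable
      (Filter.Eventually.of_forall fun x => abs_riemannDatum_le _ _ x)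
  · obtain ⟨T, hT, hTφ⟩ := exists_time_bound hc
    have hb := hbal T hT
    simp only [one_mul, sub_self, zero_mul, integral_zero, add_zero] at hb
    have hφT : ∀ x, φ (x, T) = 0 := fun x => image_eq_zero_of_notMem_tsupport (hTφ (x, T) le_rfl)
    simp only [hφT, mul_zero, integral_zero, zero_sub] at hb
    rw [← hinit']
    have hswap : ∫ t in Ioi (0 : ℝ), ∫ x : ℝ,
        ((riemannU a ul ur zr x t + riemannW a ul ur zl zr x t) * dt φ x t +
          riemannU a ul ur zr x t * dx φ x t) =
        ∫ p in univ ×ˢ Ioi 0, ((riemannU a ul ur zr p.1 p.2 + riemannW a ul ur zl zr p.1 p.2) *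
          dt φ p.1 p.2 + riemannU a ul ur zr p.1 p.2 * dx φ p.1 p.2) := by
      have hint' := hint
      rw [IntegrableOn, Measure.volume_eq_prod, ← Measure.prod_restrict,
        Measure.restrict_univ] at hint'
      rw [Measure.volume_eq_prod, ← Measure.prod_restrict, Measure.restrict_univ,
        integral_prod_symm _ hint']
    rw [hswap, setIntegral_eq_of_subset_of_forall_sdiff_eq_zero
      (MeasurableSet.univ.prod measurableSet_Ioi)
      (prod_mono_right (Ioc_subset_Ioi_self : Ioc 0 T ⊆ Ioi 0)), hb]
    · ring
    · rintro p ⟨⟨-, hp0⟩, hpT⟩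
      have hp : T ≤ p.2 := by
        by_contra hcon
        exact hpT ⟨mem_univ _, hp0, (not_le.1 hcon).le⟩
      rw [dt_eq_zero_of_notMem_tsupport hφ (hTφ p hp), dx_eq_zero_of_notMem_tsupport hφ (hTφ p hp)]
      ring

lemma integral_sign (k : ℝ) {U : ℝ} (hU : ur ≤ U) :
    ∫ v in Icc ur U, (if v < k then (-1 : ℝ) else 1) = |U - k| - |ur - k| := by
  rw [integral_Icc_eq_integral_Ioc, ← intervalIntegral.integral_of_le hU]
  have hm : ∀ r s : ℝ, IntervalIntegrable (fun v => if v < k then (-1 : ℝ) else 1) volume r s := by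
    intro r s
    have h : ∀ r s : ℝ, IntegrableOn (fun v => if v < k then (-1 : ℝ) else 1) (Ioc r s) :=
      fun r s => Integrable.of_bound (Measurable.ite (measurableSet_lt measurable_id
        measurable_const) measurable_const measurable_const).aestronglyMeasurable 1
        (Filter.Eventually.of_forall fun v => by split_ifs <;> simp)
    exact ⟨h r s, h s r⟩
  have h1 : ∀ s, ∫ v in k..s, (if v < k then (-1 : ℝ) else 1) = |s - k| := by
    intro s
    rcases le_total k s with hs | hs
    · rw [intervalIntegral.integral_of_le hs, abs_of_nonneg (sub_nonneg.2 hs),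
        setIntegral_congr_fun (g := fun _ => (1 : ℝ)) measurableSet_Ioc
          (fun v hv => if_neg hv.1.not_gt)]
      simp [hs]
    · rw [intervalIntegral.integral_of_ge hs, abs_of_nonpos (sub_nonpos.2 hs),
        integral_Ioc_eq_integral_Ioo, setIntegral_congr_fun (g := fun _ => (-1 : ℝ))
          measurableSet_Ioo (fun v hv => if_pos hv.2)]
      simp [hs]
  rw [← intervalIntegral.integral_add_adjacent_intervals (hm ur k) (hm k U), h1,
    intervalIntegral.integral_symm k ur, h1]
  ring

/-- The entropy inequalities, tested against all compatible configurations in the sense of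
`IsConfig`. This class contains all generated configurations, and unlike them it is visibly
invariant under reflections. -/
def SatisfiesEntropyInequalities (a T : ℝ) (u : ℝ → ℝ → ℝ) (z : ℝ → ℝ → ℝ × ℝ → ℝ) : Prop :=
  ∀ (k : ℝ) (zhat : ℝ × ℝ → ℝ), IsConfig zhat → Compatible a k zhat →
    ∀ φ : ℝ × ℝ → ℝ, ContDiff ℝ ∞ φ → HasCompactSupport φ → (∀ p ∈ tsupport φ, 0 < p.2) →
      (∀ p, 0 ≤ φ p) →
      IntegrableOn (fun p : ℝ × ℝ =>
        (|u p.1 p.2 - k| + ∫ ρ in triangle a, |z p.1 p.2 ρ - zhat ρ|) * dt φ p.1 p.2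
          + |u p.1 p.2 - k| * dx φ p.1 p.2) (univ ×ˢ Ioc 0 T) ∧
      0 ≤ ∫ x : ℝ, ∫ t in (0 : ℝ)..T,
        ((|u x t - k| + ∫ ρ in triangle a, |z x t ρ - zhat ρ|) * dt φ x t
          + |u x t - k| * dx φ x t)

lemma abs_sub_abs_sub_le {z zhat : ℝ × ℝ → ℝ} (hz : IsConfig z) :
    ∀ ρ ∈ triangle a, |(|1 - zhat ρ| - |z ρ - zhat ρ|)| ≤ 1 - z ρ := by
  intro ρ hρ
  have h := abs_abs_sub_abs_le_abs_sub (1 - zhat ρ) (z ρ - zhat ρ)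
  refine h.trans ?_
  rw [sub_sub_sub_cancel_right]
  rcases hz.values ρ (triangle_subset_plane a hρ) with h | h <;> rw [h] <;> norm_num

lemma measurable_indicator_abs_sub_abs_sub {z zhat : ℝ × ℝ → ℝ} (hz : IsConfig z)
    (hzhat : IsConfig zhat) :
    Measurable ((triangle a).indicator fun ρ => |1 - zhat ρ| - |z ρ - zhat ρ|) := by
  have h : ((triangle a).indicator fun ρ => |1 - zhat ρ| - |z ρ - zhat ρ|) =
      (triangle a).indicator fun ρ => |1 - plane.indicator zhat ρ| -
        |plane.indicator z ρ - plane.indicator zhat ρ| := by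
    refine indicator_congr fun ρ hρ => ?_
    rw [indicator_of_mem (triangle_subset_plane a hρ),
      indicator_of_mem (triangle_subset_plane a hρ)]
  rw [h]
  exact ((measurable_const.sub hzhat.measurable_indicator).norm.sub
    (hz.measurable_indicator.sub hzhat.measurable_indicator).norm).indicator
      (measurableSet_triangle a)

/-- Below `k`, where the relays of `zhat` are in state `+1`, the switching relays approach
`zhat`. -/
lemma ae_sliceIntegral_of_lt {k : ℝ} {z zhat : ℝ × ℝ → ℝ} (hz : IsConfig z)
    (hzhat : IsConfig zhat) (hc : Compatible a k zhat) :
    ∀ᵐ v : ℝ, v < k → sliceIntegral a (fun ρ => |1 - zhat ρ| - |z ρ - zhat ρ|) v =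
      -(gUp a z v - 1) := by
  filter_upwards [ae_slice (ae_compatible hzhat hc)] with v hv hvk
  rw [← hz.sliceIntegral_one_sub, sliceIntegral, sliceIntegral, ← integral_neg]
  refine integral_congr_ae ?_
  filter_upwards [hv] with r hr
  by_cases h : (r, v) ∈ triangle a
  · rw [indicator_of_mem h, indicator_of_mem h, (hr h).2 hvk.le]
    rcases hz.values _ (triangle_subset_plane a h) with h1 | h1 <;> rw [h1] <;> norm_num
  · rw [indicator_of_notMem h, indicator_of_notMem h, neg_zero]

/-- Each front of the solution satisfies the entropy inequality: with an equality if its value lies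
below `k`, and above `k` because each switching relay increases the distance from `zhat` by `2` at
most. -/
theorem entropyInequalities_of_le (ha : 0 < a) (hT : 0 < T) (hul : ul ≤ a) (hur : -a ≤ ur)
    (h : ur ≤ ul) (hzl : IsConfig zl) (hzr : IsConfig zr)
    (hcl : Compatible a ul zl) (hcr : Compatible a ur zr) :
    SatisfiesEntropyInequalities a T (riemannU a ul ur zr) (riemannZ a ul ur zl zr) := by
  intro k zhat hzhat hck φ hφ hc hsupp hφ0
  have hφ1 : ContDiff ℝ 1 φ := hφ.of_le (by norm_cast)
  have hg : ∀ v w, ur ≤ v → v ≤ w → w ≤ ul → gUp a zr v + 2 * (w - v) ≤ gUp a zr w :=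
    fun v w h1 h2 h3 => hzr.gUp_add_le hcr hur h1 h2 (h3.trans hul)
  set D : ℝ × ℝ → ℝ := fun ρ => |1 - zhat ρ| - |zr ρ - zhat ρ| with hD
  set s : ℝ → ℝ := fun v => if v < k then -1 else 1 with hs
  have hsm : Measurable s :=
    Measurable.ite (measurableSet_lt measurable_id measurable_const) measurable_const
      measurable_const
  have hsb : ∀ v, |s v| ≤ 1 := fun v => by simp only [hs]; split_ifs <;> simp
  have hdm : Measurable (sliceIntegral a D) :=
    measurable_sliceIntegral (measurable_indicator_abs_sub_abs_sub hzr hzhat)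
  have hdg : ∀ v, |sliceIntegral a D v| ≤ gUp a zr v - 1 :=
    hzr.abs_sliceIntegral_le (abs_sub_abs_sub_le hzr)
  have hdb : ∀ v, |sliceIntegral a D v| ≤ 4 * a := fun v => by
    have h1 := abs_gUp_le (zr := zr) ha v
    rw [abs_of_nonneg (zero_le_one.trans (one_le_gUp v))] at h1
    linarith [hdg v]
  have hAb : ∀ v, |s v + sliceIntegral a D v| ≤ 1 + 4 * a := fun v =>
    (abs_add_le _ _).trans (add_le_add (hsb v) (hdb v))
  set el := |ur - k| + ((∫ ρ in triangle a, |zl ρ - zhat ρ|) -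
    ∫ v in Icc ur ul, sliceIntegral a D v) with hel
  set er := |ur - k| + ∫ ρ in triangle a, |zr ρ - zhat ρ| with her
  have hQ : ∀ x t, x ≠ 0 → 0 ≤ t → |riemannU a ul ur zr x t - k| =
      |ur - k| + ∫ v in Icc ur ul, s v * front (gUp a zr v) x t := by
    intro x t _ ht
    rw [integral_mul_front hg h ht, integral_sign k (riemannU_mem_Icc h x t).1]
    ring
  have hE : ∀ x t, x ≠ 0 → 0 ≤ t → |riemannU a ul ur zr x t - k| +
      ∫ ρ in triangle a, |riemannZ a ul ur zl zr x t ρ - zhat ρ| =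
      riemannDatum el er x +
        ∫ v in Icc ur ul, (s v + sliceIntegral a D v) * front (gUp a zr v) x t := by
    intro x t hx ht
    have h1 := integral_riemannZ_of_le hzl hzr h hul hur hcl hcr (P := fun ρ w => |w - zhat ρ|)
      (fun w hw => (hw.integrableOn.sub hzhat.integrableOn).abs)
      (((integrableOn_const (volume_triangle_lt_top a).ne).sub hzhat.integrableOn).abs) hx ht
    have hF : ∀ {F : ℝ → ℝ} {C : ℝ}, Measurable F → (∀ v, |F v| ≤ C) →
        IntegrableOn (fun v => F v * front (gUp a zr v) x t) (Icc ur ul) := by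
      intro F C hFm hFb
      refine Integrable.of_bound (C := C) ((hFm.mul (measurable_front hzr.measurable_gUp
        measurable_const measurable_const)).aestronglyMeasurable)
        (Filter.Eventually.of_forall fun v => abs_mul_front_le hFb v _ _ _)
    rw [hQ x t hx ht, h1]
    simp only [add_mul]
    rw [integral_add (hF hsm hsb) (hF hdm hdb)]
    unfold riemannDatum
    split_ifs <;> ring
  obtain ⟨hint, hbal⟩ := balance_of_fronts (C := (|el| + |er|) + (1 + 4 * a)) hzr hφ1 hc
    (hsm.add hdm)
    (fun v => (hAb v).trans (le_add_of_nonneg_left (by positivity)))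
    hsm (fun v => (hsb v).trans (by nlinarith [abs_nonneg el, abs_nonneg er]))
    (measurable_riemannDatum el er)
    (fun x => (abs_riemannDatum_le el er x).trans (le_add_of_nonneg_right (by positivity))) hE hQ
  have hint' := hint.mono_set (prod_mono_right (Ioc_subset_Ioi_self : Ioc 0 T ⊆ Ioi 0))
  refine ⟨hint', ?_⟩
  have hswap := hint'
  rw [Measure.volume_eq_prod] at hswap
  have hiter := setIntegral_prod _ hswap
  rw [← Measure.volume_eq_prod, setIntegral_univ, hbal T hT] at hiter
  simp only [intervalIntegral.integral_of_le hT.le]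
  rw [← hiter]
  have hzero : ∀ x, φ (x, 0) = 0 := fun x =>
    image_eq_zero_of_notMem_tsupport fun hx => lt_irrefl _ (hsupp _ hx)
  simp only [hzero, mul_zero, integral_zero, sub_zero]
  refine add_nonneg (integral_nonneg fun x => mul_nonneg (add_nonneg (abs_nonneg _)
    (integral_nonneg fun ρ => abs_nonneg _)) (hφ0 _)) (integral_nonneg_of_ae ?_)
  filter_upwards [ae_restrict_of_ae (ae_sliceIntegral_of_lt hzr hzhat hck)] with v hv
  refine mul_nonneg ?_ (setIntegral_nonneg measurableSet_Ioc fun x _ => hφ0 _)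
  change 0 ≤ s v * gUp a zr v - (s v + sliceIntegral a D v)
  by_cases hvk : v < k
  · have hv' : sliceIntegral a D v = _ := hv hvk
    rw [hv', show s v = -1 from if_pos hvk]; linarith
  · have := (le_abs_self _).trans (hdg v)
    rw [show s v = 1 from if_neg hvk]; linarith

end Up

/-! ### Reflection -/

/-- The reflection of the plane of thresholds at the antidiagonal `ρ₂ = -ρ₁`. -/
def reflect : (ℝ × ℝ) ≃ₜ (ℝ × ℝ) where
  toFun ρ := (-ρ.2, -ρ.1)
  invFun ρ := (-ρ.2, -ρ.1)
  left_inv ρ := by simp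
  right_inv ρ := by simp
  continuous_toFun := by fun_prop
  continuous_invFun := by fun_prop

/-- The configuration that corresponds to `z` when the sign of the input is changed. -/
def reflectState (z : ℝ × ℝ → ℝ) (ρ : ℝ × ℝ) : ℝ := -z (reflect ρ)

lemma reflect_apply (ρ : ℝ × ℝ) : reflect ρ = (-ρ.2, -ρ.1) := rfl

lemma reflect_reflect (ρ : ℝ × ℝ) : reflect (reflect ρ) = ρ := by simp [reflect_apply]

lemma reflect_mem_plane {ρ : ℝ × ℝ} : reflect ρ ∈ plane ↔ ρ ∈ plane := by
  simp [reflect_apply, plane]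

lemma reflect_mem_triangle {a : ℝ} {ρ : ℝ × ℝ} : reflect ρ ∈ triangle a ↔ ρ ∈ triangle a := by
  simp only [reflect_apply, triangle, mem_ofPred_eq, neg_le_neg_iff, neg_lt_neg_iff]
  constructor
  · rintro ⟨h1, h2, h3⟩; exact ⟨by linarith, h2, h1⟩
  · rintro ⟨h1, h2, h3⟩; exact ⟨h3, h2, by linarith⟩

lemma reflect_preimage_triangle (a : ℝ) : reflect ⁻¹' triangle a = triangle a :=
  ext fun _ => reflect_mem_triangle

lemma measurePreserving_reflect : MeasurePreserving reflect := by
  have h1 : MeasurePreserving (Prod.swap : ℝ × ℝ → ℝ × ℝ) := Measure.measurePreserving_swap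
  exact (Measure.measurePreserving_neg (volume : Measure (ℝ × ℝ))).comp h1

lemma setIntegral_reflect (a : ℝ) (f : ℝ × ℝ → ℝ) :
    ∫ ρ in triangle a, f (reflect ρ) = ∫ ρ in triangle a, f ρ := by
  have h := measurePreserving_reflect.setIntegral_preimage_emb reflect.measurableEmbedding f
    (triangle a)
  rwa [reflect_preimage_triangle] at h

lemma measurePreserving_reflect_restrict (a : ℝ) : MeasurePreserving reflect
    (volume.restrict (triangle a)) (volume.restrict (triangle a)) := by
  have h := measurePreserving_reflect.restrict_preimage (measurableSet_triangle a)
  rwa [reflect_preimage_triangle] at h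

lemma ae_reflect {a : ℝ} {p : ℝ × ℝ → Prop} (h : ∀ᵐ ρ ∂(volume.restrict (triangle a)), p ρ) :
    ∀ᵐ ρ ∂(volume.restrict (triangle a)), p (reflect ρ) :=
  (measurePreserving_reflect_restrict a).quasiMeasurePreserving.ae h

lemma IsConfig.reflect {z : ℝ × ℝ → ℝ} (hz : IsConfig z) : IsConfig (reflectState z) := by
  refine ⟨?_, fun ρ hρ => ?_, fun ρ hρ ρ' hρ' hle h => ?_⟩
  · have hm : Measurable fun ρ : plane =>
        (⟨PreisachRiemann.reflect ρ, reflect_mem_plane.2 ρ.2⟩ : plane) :=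
      (PreisachRiemann.reflect.continuous.measurable.comp measurable_subtype_coe).subtype_mk
    exact (hz.measurable.comp hm).neg
  · unfold reflectState
    rcases hz.values _ (reflect_mem_plane.2 hρ) with h | h <;> simp [h]
  · unfold reflectState at h ⊢
    rcases hz.values _ (reflect_mem_plane.2 hρ') with h' | h'
    · rw [h']
    · have := hz.antitone _ (reflect_mem_plane.2 hρ') _ (reflect_mem_plane.2 hρ)
        ⟨neg_le_neg hle.2, neg_le_neg hle.1⟩ h'
      rw [this] at h; norm_num at h

lemma Compatible.reflect {a k : ℝ} {z : ℝ × ℝ → ℝ} (h : Compatible a k z) :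
    Compatible a (-k) (reflectState z) := by
  unfold Compatible
  filter_upwards [ae_reflect h] with ρ hρ
  rcases hρ with ⟨h1, h2⟩ | ⟨h1, h2⟩
  · exact Or.inr ⟨by simp only [reflect_apply] at h1 ⊢; linarith,
      by simp only [reflectState] at h2 ⊢; linarith⟩
  · exact Or.inl ⟨by simp only [reflect_apply] at h1 ⊢; linarith,
      by simp only [reflectState] at h2 ⊢; linarith⟩

lemma graph_reflectState (z : ℝ × ℝ → ℝ) : graph (reflectState z) = reflect ⁻¹' graph z := by
  have h1 : {ρ | ρ ∈ plane ∧ reflectState z ρ = -1} = reflect ⁻¹' {ρ | ρ ∈ plane ∧ z ρ = 1} := by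
    ext ρ
    simp only [mem_ofPred_eq, mem_preimage, reflect_mem_plane, reflectState, neg_inj]
  have h2 : {ρ | ρ ∈ plane ∧ reflectState z ρ = 1} = reflect ⁻¹' {ρ | ρ ∈ plane ∧ z ρ = -1} := by
    ext ρ
    simp only [mem_ofPred_eq, mem_preimage, reflect_mem_plane, reflectState, neg_eq_iff_eq_neg]
  unfold graph
  rw [h1, h2, ← reflect.preimage_frontier, ← reflect.preimage_frontier, preimage_inter, inter_comm]

lemma HasFiniteGraph.reflect {a : ℝ} {z : ℝ × ℝ → ℝ} (h : HasFiniteGraph a z) :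
    HasFiniteGraph a (reflectState z) := by
  classical
  obtain ⟨H, V, hHV⟩ := h
  refine ⟨V.image Neg.neg, H.image Neg.neg, fun ρ hρ => ?_⟩
  rw [graph_reflectState] at hρ
  rcases hHV (PreisachRiemann.reflect ρ) ⟨hρ.1, reflect_mem_triangle.2 hρ.2⟩ with h | h | h
  · left; simp only [reflect_apply] at h; linarith
  · exact Or.inr (Or.inr (Finset.mem_image.2 ⟨_, h, by simp [reflect_apply]⟩))
  · exact Or.inr (Or.inl (Finset.mem_image.2 ⟨_, h, by simp [reflect_apply]⟩))

lemma gUp_reflectState (a : ℝ) (z : ℝ × ℝ → ℝ) (v : ℝ) :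
    gUp a (reflectState z) v = gDown a z (-v) := by
  unfold gUp gDown horizLength vertLength
  have h : {r : ℝ | (r, v) ∈ triangle a ∧ reflectState z (r, v) = -1} =
      Neg.neg ⁻¹' {r : ℝ | (-v, r) ∈ triangle a ∧ z (-v, r) = 1} := by
    ext r
    simp only [mem_ofPred_eq, mem_preimage, reflectState, neg_inj]
    rw [← reflect_mem_triangle, reflect_apply]
  rw [h, Measure.measure_preimage_neg]

lemma riemannU_reflect {a ul ur : ℝ} (h : ul < ur) (z : ℝ × ℝ → ℝ) (x t : ℝ) :
    riemannU a ul ur z x t = -riemannU a (-ul) (-ur) (reflectState z) x t := by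
  unfold riemannU
  rw [if_neg h.not_ge, if_pos (neg_le_neg h.le), Real.sInf_def]
  congr 2
  ext v
  simp only [Set.mem_neg, mem_insert_iff, mem_ofPred_eq, mem_Icc, gUp_reflectState]
  refine or_congr neg_eq_iff_eq_neg (and_congr_left fun _ => ?_)
  constructor
  · rintro ⟨h1, h2⟩; exact ⟨by linarith, by linarith⟩
  · rintro ⟨h1, h2⟩; exact ⟨by linarith, by linarith⟩

/-- Changing the sign of the input exchanges the two switching conditions; they exclude each other,
so that their order in the definition of the relay does not matter. -/
lemma relay_reflect (ρ : ℝ × ℝ) (u : ℝ → ℝ) (z₀ t : ℝ) :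
    relay ρ (fun s => -u s) (-z₀) t = -relay (reflect ρ) u z₀ t := by
  have hA : (∃ s ∈ Icc 0 t, ρ.2 ≤ -u s ∧ ∀ r ∈ Icc s t, ρ.1 < -u r) ↔
      ∃ s ∈ Icc 0 t, u s ≤ (reflect ρ).1 ∧ ∀ r ∈ Icc s t, u r < (reflect ρ).2 := by
    simp only [reflect_apply, le_neg, lt_neg]
  have hB : (∃ s ∈ Icc 0 t, -u s ≤ ρ.1 ∧ ∀ r ∈ Icc s t, -u r < ρ.2) ↔
      ∃ s ∈ Icc 0 t, (reflect ρ).2 ≤ u s ∧ ∀ r ∈ Icc s t, (reflect ρ).1 < u r := by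
    simp only [reflect_apply, neg_le, neg_lt]
  have hexcl : ¬ ((∃ s ∈ Icc 0 t, ρ.2 ≤ -u s ∧ ∀ r ∈ Icc s t, ρ.1 < -u r) ∧
      ∃ s ∈ Icc 0 t, -u s ≤ ρ.1 ∧ ∀ r ∈ Icc s t, -u r < ρ.2) := by
    rintro ⟨⟨s, hs, h1, h2⟩, ⟨s', hs', h3, h4⟩⟩
    rcases le_total s s' with hss | hss
    · exact (h2 s' ⟨hss, hs'.2⟩).not_ge h3
    · exact (h4 s ⟨hss, hs.2⟩).not_ge h1
  unfold relay
  rw [← hA, ← hB]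
  split_ifs with h1 h2 h2
  · exact absurd ⟨h1, h2⟩ hexcl
  · simp
  · rfl
  · rfl

section Down

variable {a ul ur : ℝ} {zl zr : ℝ × ℝ → ℝ}

lemma riemannZ_reflect (h : ul < ur) (x t : ℝ) (ρ : ℝ × ℝ) :
    riemannZ a ul ur zl zr x t ρ =
      -riemannZ a (-ul) (-ur) (reflectState zl) (reflectState zr) x t (reflect ρ) := by
  unfold riemannZ
  simp only [riemannU_reflect h]
  have h1 : riemannDatum zl zr x ρ =
      -riemannDatum (reflectState zl) (reflectState zr) x (reflect ρ) := by
    unfold riemannDatum reflectState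
    split_ifs <;> simp only [reflect_reflect, neg_neg]
  rw [h1, relay_reflect]

lemma setIntegral_riemannZ_reflect (h : ul < ur) (x t : ℝ) {P Q : ℝ × ℝ → ℝ → ℝ}
    (hPQ : ∀ ρ w, P ρ (-w) = Q (reflect ρ) w) :
    ∫ ρ in triangle a, P ρ (riemannZ a ul ur zl zr x t ρ) = ∫ ρ in triangle a,
      Q ρ (riemannZ a (-ul) (-ur) (reflectState zl) (reflectState zr) x t ρ) := by
  rw [← setIntegral_reflect a fun ρ =>
    Q ρ (riemannZ a (-ul) (-ur) (reflectState zl) (reflectState zr) x t ρ)]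
  refine integral_congr_ae (Filter.Eventually.of_forall fun ρ => ?_)
  simp only [riemannZ_reflect h, hPQ]

lemma riemannW_reflect (h : ul < ur) (x t : ℝ) : riemannW a ul ur zl zr x t =
    -riemannW a (-ul) (-ur) (reflectState zl) (reflectState zr) x t := by
  unfold riemannW
  rw [setIntegral_riemannZ_reflect h x t (P := fun _ w => w) (Q := fun _ w => -w)
    (fun _ _ => rfl), integral_neg]

lemma IsRarefactionFan.reflect {g : ℝ → ℝ} {u : ℝ → ℝ → ℝ}
    (h : IsRarefactionFan 1 (-ul) (-ur) g u) :
    IsRarefactionFan (-1) ul ur (fun y => g (-y)) (fun x t => -u x t) := by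
  obtain ⟨n, v, m, c, hv0, hvn, hlt, hmc, hg, hjump, hu⟩ := h
  have haff : ∀ i y, affineG (-1) (c i) (-m i) (-y) = affineG 1 (c i) (m i) y := fun i y => by
    unfold affineG; ring
  refine ⟨n, fun i => -v i, fun i => -m i, c, by simp [hv0], by simp [hvn],
    fun i hi => by simpa using hlt i hi, fun i hi => ?_, fun i hi y h1 h2 => ?_,
    fun i hi => ?_, fun x t ht => ?_⟩
  · refine ⟨?_, by simpa using (hmc i hi).2⟩
    rcases (hmc i hi).1 with h | ⟨h, h'⟩
    · exact Or.inl h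
    · exact Or.inr ⟨h, by simp [h']⟩
  · simp only
    rw [hg i hi (-y) (by simpa using h1) (by simpa using h2), ← haff, neg_neg]
  · simpa only [haff] using hjump i hi
  · obtain ⟨h1, h2, h3, h4⟩ := hu x t ht
    simp only [haff]
    refine ⟨fun h => ?_, fun i hi ha hb => ?_, fun i hi ha hb => ?_, fun h => ?_⟩
    · rw [h1 h, neg_neg]
    · rw [h2 i hi ha hb]; ring
    · rw [h3 i hi ha hb]
    · rw [h4 h, neg_neg]

lemma IsWeakSolution.neg {u w u' w' : ℝ → ℝ → ℝ} {u₀ w₀ u₀' w₀' : ℝ → ℝ}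
    (h : IsWeakSolution u' w' u₀' w₀') (hu : ∀ x t, u x t = -u' x t)
    (hw : ∀ x t, w x t = -w' x t) (hu₀ : ∀ x, u₀ x = -u₀' x) (hw₀ : ∀ x, w₀ x = -w₀' x) :
    IsWeakSolution u w u₀ w₀ := by
  intro φ hφ hc
  obtain ⟨h1, h2, h3⟩ := h φ hφ hc
  have e1 : ∀ x t, (u x t + w x t) * dt φ x t + u x t * dx φ x t =
      -((u' x t + w' x t) * dt φ x t + u' x t * dx φ x t) := fun x t => by rw [hu, hw]; ring
  have e2 : ∀ x, (u₀ x + w₀ x) * φ (x, 0) = -((u₀' x + w₀' x) * φ (x, 0)) := fun x => by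
    rw [hu₀, hw₀]; ring
  simp only [e1, e2, integral_neg]
  refine ⟨h1.neg, h2.neg, by linarith⟩

lemma HasWaveStates.reflect (h : ul < ur)
    (hw : HasWaveStates a (-ul) (-ur) (reflectState zl) (reflectState zr)
      (riemannU a (-ul) (-ur) (reflectState zr))
      (riemannZ a (-ul) (-ur) (reflectState zl) (reflectState zr))) :
    HasWaveStates a ul ur zl zr (riemannU a ul ur zr) (riemannZ a ul ur zl zr) := by
  refine fun x t ht => ⟨fun hx => ?_, fun _ h' => absurd h' h.not_ge, fun hx _ => ?_⟩
  · filter_upwards [ae_reflect ((hw x t ht).1 hx)] with ρ hρ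
    rw [riemannZ_reflect h, hρ, reflectState, reflect_reflect,
      neg_neg]
  · filter_upwards [ae_reflect ((hw x t ht).2.1 hx (neg_le_neg h.le))] with ρ hρ
    rw [riemannZ_reflect h, hρ, reflectState, reflect_reflect,
      riemannU_reflect h, reflect_apply]
    simp only [neg_le]
    split_ifs
    · rfl
    · rw [neg_neg]

lemma SatisfiesEntropyInequalities.reflect {T : ℝ} (h : ul < ur)
    (he : SatisfiesEntropyInequalities a T (riemannU a (-ul) (-ur) (reflectState zr))
      (riemannZ a (-ul) (-ur) (reflectState zl) (reflectState zr))) :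
    SatisfiesEntropyInequalities a T (riemannU a ul ur zr) (riemannZ a ul ur zl zr) := by
  intro k zhat hzhat hck φ hφ hc hs hφ0
  have hu : ∀ x t, |riemannU a ul ur zr x t - k| =
      |riemannU a (-ul) (-ur) (reflectState zr) x t - -k| := fun x t => by
    rw [riemannU_reflect h, ← abs_neg]; congr 1; ring
  have hz : ∀ x t, ∫ ρ in triangle a, |riemannZ a ul ur zl zr x t ρ - zhat ρ| =
      ∫ ρ in triangle a, |riemannZ a (-ul) (-ur) (reflectState zl) (reflectState zr) x t ρ -
        reflectState zhat ρ| := fun x t =>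
    setIntegral_riemannZ_reflect h x t (P := fun ρ w => |w - zhat ρ|)
      (Q := fun ρ w => |w - reflectState zhat ρ|) fun ρ w => by
        simp only [reflectState, reflect_reflect]
        rw [← abs_neg]; congr 1; ring
  simp only [hu, hz]
  exact he (-k) (reflectState zhat) hzhat.reflect hck.reflect φ hφ hc hs hφ0

end Down

/-! ### Solution of the Riemann problem -/

section Main

variable {a T ul ur : ℝ} {zl zr : ℝ × ℝ → ℝ}

lemma IsEntropySolution.of_inequalities
    (hi : ∀ x t, 0 ≤ t → IntegrableOn (riemannZ a ul ur zl zr x t) (triangle a))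
    (he : SatisfiesEntropyInequalities a T (riemannU a ul ur zr) (riemannZ a ul ur zl zr)) :
    IsEntropySolution a T (riemannU a ul ur zr) (riemannW a ul ur zl zr)
      (riemannZ a ul ur zl zr) :=
  ⟨fun x t ht => ⟨hi x t ht, rfl⟩,
    fun k zhat hzhat => he k zhat (isConfig_of_mem_states hzhat)⟩

lemma riemannU_continuousOn_and_zero {z : ℝ × ℝ → ℝ} (h : ur ≤ ul) (hul : ul ≤ a)
    (hur : -a ≤ ur) (hz : IsConfig z) (hc : Compatible a ur z) {x : ℝ} (hx : x ≠ 0) :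
    ContinuousOn (riemannU a ul ur z x) (Ici 0) ∧
      riemannU a ul ur z x 0 = riemannDatum ul ur x := by
  refine ⟨continuousOn_riemannU
    (fun v w h1 h2 h3 => hz.gUp_add_le hc hur h1 h2 (h3.trans hul)) h hx, ?_⟩
  unfold riemannDatum
  rcases hx.lt_or_gt with hx | hx
  · rw [if_pos hx, riemannU_of_nonpos h hx.le le_rfl]
  · rw [if_neg hx.not_gt, riemannU_zero h hx]

theorem riemannProblem_of_le (ha : 0 < a) (hT : 0 < T) (hul : ul ≤ a) (hur : -a ≤ ur)
    (h : ur ≤ ul) (hzl : IsConfig zl) (hzr : IsConfig zr) (hcl : Compatible a ul zl)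
    (hcr : Compatible a ur zr) (hf : HasFiniteGraph a zr) :
    IsRiemannSolution a ul ur zl zr (riemannU a ul ur zr) (riemannW a ul ur zl zr)
        (riemannZ a ul ur zl zr) ∧
      IsEntropySolution a T (riemannU a ul ur zr) (riemannW a ul ur zl zr)
        (riemannZ a ul ur zl zr) := by
  refine ⟨⟨fun x hx => riemannU_continuousOn_and_zero h hul hur hzr hcr hx,
    fun _ _ _ _ _ _ => rfl, fun _ _ _ => rfl,
    isWeakSolution_of_le ha hul hur h hzl hzr hcl hcr,
    fun h' => isRarefactionFan_riemannU hul hur h' hzr hcr hf,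
    fun h' => absurd h h'.not_ge, fun h' x t _ => ?_,
    hasWaveStates_of_le h hzl hzr hcl hcr⟩,
    .of_inequalities (fun x t ht => integrableOn_riemannZ_of_le h hzl hzr ht)
      (entropyInequalities_of_le ha hT hul hur h hzl hzr hcl hcr)⟩
  have hU := riemannU_mem_Icc (a := a) (z := zr) h x t
  exact le_antisymm hU.2 (h'.le.trans hU.1)

theorem riemannProblem_of_lt (ha : 0 < a) (hT : 0 < T) (hul : -a ≤ ul) (hur : ur ≤ a)
    (h : ul < ur) (hzl : IsConfig zl) (hzr : IsConfig zr) (hcl : Compatible a ul zl)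
    (hcr : Compatible a ur zr) (hf : HasFiniteGraph a zr) :
    IsRiemannSolution a ul ur zl zr (riemannU a ul ur zr) (riemannW a ul ur zl zr)
        (riemannZ a ul ur zl zr) ∧
      IsEntropySolution a T (riemannU a ul ur zr) (riemannW a ul ur zl zr)
        (riemannZ a ul ur zl zr) := by
  have h' : -ur ≤ -ul := neg_le_neg h.le
  have hul' : -ul ≤ a := by linarith
  have hur' : -a ≤ -ur := neg_le_neg hur
  have hU : riemannU a ul ur zr =
      fun x t => -riemannU a (-ul) (-ur) (reflectState zr) x t :=
    funext fun x => funext fun t => riemannU_reflect h zr x t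
  refine ⟨⟨fun x hx => ?_, fun _ _ _ _ _ _ => rfl, fun _ _ _ => rfl, ?_,
    fun h'' => absurd h h''.not_gt, fun _ => ?_, fun h'' => absurd h'' h.ne, ?_⟩,
    .of_inequalities (fun x t ht => ?_) ?_⟩
  · obtain ⟨h1, h2⟩ := riemannU_continuousOn_and_zero h' hul' hur' hzr.reflect hcr.reflect hx
    rw [hU]
    refine ⟨h1.neg, ?_⟩
    simp only [h2]
    unfold riemannDatum
    split_ifs <;> simp
  · refine (isWeakSolution_of_le ha hul' hur' h' hzl.reflect hzr.reflect hcl.reflect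
      hcr.reflect).neg (riemannU_reflect h zr) (riemannW_reflect h) (fun x => ?_) (fun x => ?_)
    · unfold riemannDatum; split_ifs <;> simp
    · rw [← integral_neg]
      refine (setIntegral_reflect a _).symm.trans (integral_congr_ae
        (Filter.Eventually.of_forall fun ρ => ?_))
      unfold riemannDatum reflectState
      split_ifs <;> simp only [neg_neg]
  · have hfan := (isRarefactionFan_riemannU hul' hur' (neg_lt_neg h) hzr.reflect hcr.reflect
      hf.reflect).reflect
    simp only [gUp_reflectState, neg_neg] at hfan
    rw [hU]
    exact hfan
  · exact (hasWaveStates_of_le h' hzl.reflect hzr.reflect hcl.reflect hcr.reflect).reflect h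
  · have hi := (measurePreserving_reflect_restrict a).integrable_comp_of_integrable
      (integrableOn_riemannZ_of_le (a := a) (x := x) h' hzl.reflect hzr.reflect ht)
    exact hi.neg.congr (Filter.Eventually.of_forall fun ρ => (riemannZ_reflect h x t ρ).symm)
  · exact (entropyInequalities_of_le ha hT hul' hur' h' hzl.reflect hzr.reflect hcl.reflect
      hcr.reflect).reflect h

end Main

end PreisachRiemann

theorem mainTheorem4 (a T : ℝ) (ha : 0 < a) (hT : 0 < T) (L : ℝ≥0) (hL : 0 < L)
    (ul ur : ℝ) (hul : ul ∈ Set.Icc (-a) a) (hur : ur ∈ Set.Icc (-a) a)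
    (zl zr : ℝ × ℝ → ℝ)
    (hzl : zl ∈ PreisachRiemann.statesLip T L) (hzr : zr ∈ PreisachRiemann.statesLip T L)
    (hcl : PreisachRiemann.Compatible a ul zl) (hcr : PreisachRiemann.Compatible a ur zr)
    (hfl : PreisachRiemann.HasFiniteGraph a zl) (hfr : PreisachRiemann.HasFiniteGraph a zr) :
    PreisachRiemann.IsRiemannSolution a ul ur zl zr
        (PreisachRiemann.riemannU a ul ur zr)
        (PreisachRiemann.riemannW a ul ur zl zr)
        (PreisachRiemann.riemannZ a ul ur zl zr) ∧
      PreisachRiemann.IsEntropySolution a T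
        (PreisachRiemann.riemannU a ul ur zr)
        (PreisachRiemann.riemannW a ul ur zl zr)
        (PreisachRiemann.riemannZ a ul ur zl zr) := by
  have hl := PreisachRiemann.isConfig_of_mem_statesLip hzl
  have hr := PreisachRiemann.isConfig_of_mem_statesLip hzr
  rcases le_or_gt ur ul with h | h
  · exact PreisachRiemann.riemannProblem_of_le ha hT hul.2 hur.1 h hl hr hcl hcr hfr
  · exact PreisachRiemann.riemannProblem_of_lt ha hT hul.1 hur.2 h hl hr hcl hcr hfr
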